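/- Let $\mathcal A$ be a bicomplete abelian category with a closed symmetric monoidal structure $(\otimes,k)$, and let $\mathcal P$ be a symmetric operad in $\mathcal A$ which is reduced: $\mathcal P_0=0$, and the unit $k\to\mathcal P_1$ is an isomorphism. Write $\mathcal P(X)=\bigoplus_{n\ge 0}\mathcal P_n\otimes_{\Sigma_n}X^{\otimes n}$ for the associated monad, $\mu^X:\mathcal P(X)\to X$ for the structure map of a $\mathcal P$-algebra $X$, and, for objects $B,X$ of $\mathcal A$, $$\mathcal P\circ(B|X)=\bigoplus_{n\ge 0}\mathcal P_n\otimes_{\Sigma_n}\bigl((X\oplus B)^{\otimes n}/B^{\otimes n}\bigr),$$ so that $\mathcal P(X\oplus B)=\mathcal P\circ(B|X)\oplus\mathcal P(B)$, where $\mathcal P\circ(B|X)$ is embedded as the kernel of the projection $\mathcal P(X\oplus B)\to\mathcal P(B)$. **Actions.** An (internal) action of a $\mathcal P$-algebra $B$ on a $\mathcal P$-algebra $X$ is a morphism $\rho:\mathcal P\circ(B|X)\to X$ of $\mathcal A$ such that (i) the composite $\mathcal P(X)\to\mathcal P\circ(B|X)\xrightarrow{\rho}X$ is $\mu^X$, and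 (ii) the two morphisms $\mathcal P\circ(\mathcal P(B)\,|\,\mathcal P\circ(B|X))\to X$, given by $\mathcal P\circ(\mu^B|\rho)$ followed by $\rho$ and by the operadic multiplication followed by $\rho$, are equal. A morphism $(B,X,\rho)\to(B',X',\rho')$ is a pair of algebra morphisms $g:B\to B'$, $f:X\to X'$ with $f\rho=\rho'\circ(\mathcal P\circ(g|f))$. This defines the category $\mathrm{Act}$. Every algebra $B$ acts on itself by $\rho^B:\mathcal P\circ(B|B)\hookrightarrow\mathcal P(B\oplus B)\to\mathcal P(B)\xrightarrow{\mu^B}B$, where the middle arrow is $\mathcal P(\mathrm{Id}\oplus\mathrm{Id})$. **Split short exact sequences.** $\mathrm{SplitEpi}$ is the category of split short exact sequences $0\to X\xrightarrow{i}E\xrightarrow{p}B\to 0$ of $\mathcal P$-algebras with a given algebra section $s$ of $p$ (exactness being exactness in $\mathcal A$), and of morphisms of such diagrams. **Precrossed modules.** $\mathrm{pXMod}$ is the category of pairs $(\rho,d)$, where $\rho$ is an action of $B$ on $X$ and $d:X\to B$ is a morphism of algebras which is $B$-equivariant: $d\rho=\rho^B\circ(\mathcal P\circ(\mathrm{Id}_B|d))$.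 Its morphisms are the morphisms $(g,f)$ of actions with $gd=d'f$. **Reflexive graphs.** $\mathrm{ReflGraph}$ is the category of diagrams of $\mathcal P$-algebras $s,t:E\rightrightarrows B$, $i:B\to E$ with $si=ti=\mathrm{Id}_B$, and of morphisms of such diagrams. **Theorem.** 1. An action $\rho$ of $B$ on $X$ makes $X\oplus B$ a $\mathcal P$-algebra with structure map $$\begin{pmatrix}\rho&0\\0&\mu^B\end{pmatrix}:\mathcal P(X\oplus B)=\mathcal P\circ(B|X)\oplus\mathcal P(B)\to X\oplus B,$$ and $0\to X\to X\oplus B\to B\to 0$ is a split short exact sequence of algebras. Conversely, a split short exact sequence $(i,p,s)$ defines an action of $B$ on $X$: the unique factorization through $i$ of $\mathcal P\circ(B|X)\hookrightarrow\mathcal P(X\oplus B)\xrightarrow{\mathcal P(i\oplus s)}\mathcal P(E)\xrightarrow{\mu^E}E$. These constructions are mutually quasi-inverse equivalences of categories $\mathrm{Act}\simeq\mathrm{SplitEpi}$. 2. Sending a precrossed module $(\rho,d)$ to the reflexive graph $X\oplus B\rightrightarrows B$ with $s=0\oplus\mathrm{Id}$, $t=d\oplus\mathrm{Id}$ and $i$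 the inclusion of $B$, and sending a reflexive graph to the action of $B$ on $\ker s$ defined by the split short exact sequence $0\to\ker s\to E\xrightarrow{s}B\to 0$ (with section $i$), together with $d=t|_{\ker s}$, are mutually quasi-inverse equivalences of categories $\mathrm{pXMod}\simeq\mathrm{ReflGraph}$. 3. The equivalence of 2 lifts that of 1: the square $$\begin{array}{ccc}\mathrm{Act}&\xrightarrow{\ \simeq\ }&\mathrm{SplitEpi}\\ {\scriptstyle U}\uparrow&&\uparrow{\scriptstyle U'}\\ \mathrm{pXMod}&\xrightarrow{\ \simeq\ }&\mathrm{ReflGraph}\end{array}$$ commutes up to natural isomorphism, where $U$ forgets $d$ and $U'$ forgets $t$, sending $(s,t,i)$ to $0\to\ker s\to E\xrightarrow{s}B\to0$ with section $i$. -/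

import Mathlib

open CategoryTheory MonoidalCategory Limits

universe v u

/-! ### Symmetric operads -/

/-- `S ⊔ (T ⊔ {*}) ≃ (S ⊔ T) ⊔ {*}`. -/
def sumOptionEquiv (S T : Type) : S ⊕ Option T ≃ Option (S ⊕ T) where
  toFun := Sum.elim (fun s => some (Sum.inl s)) (Option.map Sum.inr)
  invFun x := x.elim (Sum.inr none) (Sum.map id some)
  left_inv := by rintro (s | _ | t) <;> rfl
  right_inv := by rintro (_ | s | t) <;> rfl

/-- `(S ⊔ {*}) ⊔ T ≃ (S ⊔ T) ⊔ {*}`. -/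
def optionSumEquiv (S T : Type) : Option S ⊕ T ≃ Option (S ⊕ T) where
  toFun := Sum.elim (Option.map Sum.inl) (fun t => some (Sum.inr t))
  invFun x := x.elim (Sum.inl none) (Sum.map some id)
  left_inv := by rintro ((_ | s) | t) <;> rfl
  right_inv := by rintro (_ | s | t) <;> rfl

/-- The exchange of the two added points of `(S ⊔ {*}) ⊔ {*}`. -/
def optionSwapEquiv (S : Type) : Option (Option S) ≃ Option (Option S) where
  toFun x := x.elim (some none) (fun y => y.elim none (fun s => some (some s)))
  invFun x := x.elim (some none) (fun y => y.elim none (fun s => some (some s)))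
  left_inv := by rintro (_ | _ | s) <;> rfl
  right_inv := by rintro (_ | _ | s) <;> rfl

/-- `(S ⊔ T) ⊔ U ≃ (S ⊔ U) ⊔ T`. -/
def sumRightCommEquiv (S T U : Type) : (S ⊕ T) ⊕ U ≃ (S ⊕ U) ⊕ T where
  toFun := Sum.elim (Sum.map Sum.inl id) (fun u => Sum.inl (Sum.inr u))
  invFun := Sum.elim (Sum.map Sum.inl id) (fun t => Sum.inl (Sum.inr t))
  left_inv := by rintro ((s | t) | u) <;> rfl
  right_inv := by rintro ((s | u) | t) <;> rfl

/-- A (unital) symmetric operad in a symmetric monoidal category, presented by its partial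
compositions: `obj S` is the object of operations whose inputs are labelled by the finite set `S`,
`map` is the relabelling of inputs along bijections (so that `obj (Fin n)` is the object of `n`-ary
operations with its action of the symmetric group), `one` is the identity operation, and
`comp S T : P(S ⊔ {*}) ⊗ P(T) ⟶ P(S ⊔ T)` plugs the output of the second operation into the input
`*` of the first one. -/
structure SymOperad (C : Type u) [Category.{v} C] [MonoidalCategory C] [SymmetricCategory C] where
  obj (S : Type) [Finite S] : C
  map {S T : Type} [Finite S] [Finite T] (e : S ≃ T) : obj S ⟶ obj T
  one : 𝟙_ C ⟶ obj Unit
  comp (S T : Type) [Finite S] [Finite T] : obj (Option S) ⊗ obj T ⟶ obj (S ⊕ T)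
  map_refl (S : Type) [Finite S] : map (Equiv.refl S) = 𝟙 (obj S)
  map_trans {S T U : Type} [Finite S] [Finite T] [Finite U] (e : S ≃ T) (f : T ≃ U) :
    map (e.trans f) = map e ≫ map f
  /-- Equivariance of the partial compositions. -/
  comp_map {S S' T T' : Type} [Finite S] [Finite S'] [Finite T] [Finite T']
    (e : S ≃ S') (f : T ≃ T') :
    (map (Equiv.optionCongr e) ⊗ₘ map f) ≫ comp S' T' = comp S T ≫ map (Equiv.sumCongr e f)
  /-- `1 ∘ q = q`. -/
  one_comp (T : Type) [Finite T] :
    (λ_ (obj T)).inv ≫ (one ≫ map (Equiv.ofUnique Unit (Option Empty))) ▷ obj T ≫ comp Empty T ≫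
      map (Equiv.emptySum Empty T) = 𝟙 (obj T)
  /-- `p ∘ 1 = p`. -/
  comp_one (S : Type) [Finite S] :
    (ρ_ (obj (Option S))).inv ≫ obj (Option S) ◁ one ≫ comp S Unit ≫
      map (Equiv.optionEquivSumPUnit S).symm = 𝟙 (obj (Option S))
  /-- Sequential associativity: `(p ∘ q) ∘ r = p ∘ (q ∘ r)`, with `r` plugged into an input
  of `q`. -/
  comp_assoc (S T U : Type) [Finite S] [Finite T] [Finite U] :
    (comp S (Option T) ≫ map (sumOptionEquiv S T)) ▷ obj U ≫ comp (S ⊕ T) U ≫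
      map (Equiv.sumAssoc S T U) =
    (α_ (obj (Option S)) (obj (Option T)) (obj U)).hom ≫ obj (Option S) ◁ comp T U ≫
      comp S (T ⊕ U)
  /-- Parallel associativity: plugging `q` and `r` into two different inputs of `p` can be done in
  either order. -/
  comp_comm (S T U : Type) [Finite S] [Finite T] [Finite U] :
    (comp (Option S) T ≫ map (optionSumEquiv S T)) ▷ obj U ≫ comp (S ⊕ T) U ≫
      map (sumRightCommEquiv S T U) =
    (α_ (obj (Option (Option S))) (obj T) (obj U)).hom ≫
      obj (Option (Option S)) ◁ (β_ (obj T) (obj U)).hom ≫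
      (α_ (obj (Option (Option S))) (obj U) (obj T)).inv ≫
      (map (optionSwapEquiv S) ▷ obj U ≫ comp (Option S) U ≫ map (optionSumEquiv S U)) ▷ obj T ≫
      comp (S ⊕ U) T

/-! ### Tensor powers -/

section TensorPowers

variable {C : Type u} [Category.{v} C] [MonoidalCategory C]

/-- The tensor power `X^{⊗ n}`, bracketed to the right. -/
def tpow (X : C) : ℕ → C
  | 0 => 𝟙_ C
  | n + 1 => X ⊗ tpow X n

/-- The morphism `f^{⊗ n}`. -/
def tpowMap {X Y : C} (f : X ⟶ Y) : (n : ℕ) → (tpow X n ⟶ tpow Y n)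
  | 0 => 𝟙 (𝟙_ C)
  | n + 1 => f ⊗ₘ tpowMap f n

/-- The concatenation `X^{⊗ a} ⊗ X^{⊗ b} ⟶ X^{⊗ (b + a)}`. -/
def tpowConcat (X : C) : (a b : ℕ) → (tpow X a ⊗ tpow X b ⟶ tpow X (b + a))
  | 0, b => (λ_ (tpow X b)).hom
  | a + 1, b => (α_ X (tpow X a) (tpow X b)).hom ≫ X ◁ tpowConcat X a b

variable [SymmetricCategory C]

/-- The isomorphism moving the `i`-th factor to the front,
`x_0 ⊗ ⋯ ⊗ x_n ↦ x_i ⊗ (x_0 ⊗ ⋯ (omit x_i) ⋯ ⊗ x_n)`. -/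
def tpowPull (X : C) : (n : ℕ) → Fin (n + 1) → (tpow X (n + 1) ⟶ X ⊗ tpow X n)
  | 0, _ => 𝟙 _
  | n + 1, i => Fin.cases (𝟙 _)
      (fun j => X ◁ tpowPull X n j ≫ (α_ X X (tpow X n)).inv ≫ (β_ X X).hom ▷ tpow X n ≫
        (α_ X X (tpow X n)).hom) i

/-- For a permutation `σ` of `{0, …, n}`, the permutation of `{0, …, n - 1}` obtained by deleting
`0` from the source and `σ 0` from the target and renumbering increasingly. -/
def permTail {n : ℕ} (σ : Equiv.Perm (Fin (n + 1))) : Equiv.Perm (Fin n) :=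
  Equiv.removeNone
    (((finSuccEquiv' (0 : Fin (n + 1))).symm.trans σ).trans (finSuccEquiv' (σ 0)))

/-- The permutation of tensor factors
`x_0 ⊗ ⋯ ⊗ x_{n-1} ↦ x_{σ 0} ⊗ ⋯ ⊗ x_{σ (n-1)}`. -/
def tpowPerm (X : C) : (n : ℕ) → Equiv.Perm (Fin n) → (tpow X n ⟶ tpow X n)
  | 0, _ => 𝟙 _
  | n + 1, σ => tpowPull X n (σ 0) ≫ X ◁ tpowPerm X n (permTail σ)

end TensorPowers

/-! ### The composition of operations applied to blocks of arguments -/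

namespace SymOperad

section Gamma

variable {C : Type u} [Category.{v} C] [MonoidalCategory C] [SymmetricCategory C] (P : SymOperad C)

/-- For `k = [k_1, …, k_n]`, the object `⨂_i (P_{k_i} ⊗ Z^{⊗ k_i})`. -/
def blocks (Z : C) : List ℕ → C
  | [] => 𝟙_ C
  | m :: k => (P.obj (Fin m) ⊗ tpow Z m) ⊗ blocks Z k

/-- `blocksTotal [k_1, …, k_n] a` is the sum of `a` and of the `k_i`. -/
def blocksTotal : List ℕ → ℕ → ℕ
  | [], a => a
  | m :: k, a => blocksTotal k (m + a)

/-- `Fin (n + 1) ⊔ Fin a ≃ (Fin n ⊔ Fin a) ⊔ {*}`, where `*` corresponds to `0 : Fin (n + 1)`. -/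
def headEquiv (n a : ℕ) : Fin (n + 1) ⊕ Fin a ≃ Option (Fin n ⊕ Fin a) :=
  (Equiv.sumCongr (finSuccEquiv n) (Equiv.refl (Fin a))).trans (optionSumEquiv (Fin n) (Fin a))

/-- `(Fin n ⊔ Fin a) ⊔ Fin m ≃ Fin n ⊔ Fin (m + a)`, where the elements of `Fin a` come before those
of `Fin m`. -/
def queueEquiv (n a m : ℕ) : (Fin n ⊕ Fin a) ⊕ Fin m ≃ Fin n ⊕ Fin (m + a) :=
  (Equiv.sumAssoc (Fin n) (Fin a) (Fin m)).trans
    (Equiv.sumCongr (Equiv.refl (Fin n)) (finSumFinEquiv.trans (finCongr (Nat.add_comm a m))))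

/-- Given relabellings and concatenations `h`, `c`, `cc`, the morphism
`o ⊗ (w ⊗ ((q ⊗ z) ⊗ r)) ↦ c (h o ⊗ q) ⊗ (cc (w ⊗ z) ⊗ r)`. -/
def plugStep {O O' O'' W Z V M : C} (R : C) (h : O ⟶ O') (c : O' ⊗ M ⟶ O'') (cc : W ⊗ Z ⟶ V) :
    O ⊗ (W ⊗ ((M ⊗ Z) ⊗ R)) ⟶ O'' ⊗ (V ⊗ R) :=
  (h ⊗ₘ (W ◁ (α_ M Z R).hom ≫ (α_ W M (Z ⊗ R)).inv ≫ (β_ W M).hom ▷ (Z ⊗ R) ≫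
    (α_ M W (Z ⊗ R)).hom ≫ M ◁ ((α_ W Z R).inv ≫ cc ▷ R))) ≫
  (α_ O' M (V ⊗ R)).inv ≫ c ▷ (V ⊗ R)

/-- The morphism
`(p; w; (q_1; z_1), …, (q_n; z_n)) ↦ (p ∘ (q_1, …, q_n); w, z_1, …, z_n)`.
The operation `p` has inputs `Fin n ⊔ Fin a`; its inputs in `Fin a` are fed with `w` and stay
untouched, its `n` other inputs are filled one after the other with the `q_i`, and the inputs of
`q_i` are put after those which are already there. -/
def gammaAux (Z : C) : (k : List ℕ) → (a : ℕ) →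
    (P.obj (Fin k.length ⊕ Fin a) ⊗ (tpow Z a ⊗ P.blocks Z k) ⟶
      P.obj (Fin (blocksTotal k a)) ⊗ tpow Z (blocksTotal k a))
  | [], a => P.map (Equiv.emptySum (Fin 0) (Fin a)) ⊗ₘ (ρ_ (tpow Z a)).hom
  | m :: k, a =>
      plugStep (P.blocks Z k) (P.map (headEquiv k.length a))
        (P.comp (Fin k.length ⊕ Fin a) (Fin m) ≫ P.map (queueEquiv k.length a m))
        (tpowConcat Z a m) ≫
      gammaAux Z k (m + a)

/-- The isomorphism `R ⟶ Z^{⊗ 0} ⊗ R`. -/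
def tpowZeroInsert (Z R : C) : R ⟶ tpow Z 0 ⊗ R :=
  (λ_ R).inv

/-- The operadic composition applied to blocks of arguments,
`P_n ⊗ ⨂_i (P_{k_i} ⊗ Z^{⊗ k_i}) ⟶ P_{k_1 + ⋯ + k_n} ⊗ Z^{⊗ (k_1 + ⋯ + k_n)}`,
`(p; (q_1; z_1), …, (q_n; z_n)) ↦ (p ∘ (q_1, …, q_n); z_1, …, z_n)`, for `k = [k_1, …, k_n]`. -/
def gamma (Z : C) (k : List ℕ) :
    P.obj (Fin k.length) ⊗ P.blocks Z k ⟶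
      P.obj (Fin (blocksTotal k 0)) ⊗ tpow Z (blocksTotal k 0) :=
  (P.map (Equiv.sumEmpty (Fin k.length) (Fin 0)).symm ⊗ₘ tpowZeroInsert Z (P.blocks Z k)) ≫
    P.gammaAux Z k 0

end Gamma

end SymOperad

/-! ### Functoriality of tensor powers -/

section TensorPowers

variable {C : Type u} [Category.{v} C] [MonoidalCategory C]

theorem tpowMap_id (X : C) : ∀ n : ℕ, tpowMap (𝟙 X) n = 𝟙 (tpow X n)
  | 0 => rfl
  | n + 1 => by
    change 𝟙 X ⊗ₘ tpowMap (𝟙 X) n = 𝟙 (X ⊗ tpow X n)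
    rw [tpowMap_id X n]
    simp

theorem tpowMap_comp {X Y Z : C} (f : X ⟶ Y) (g : Y ⟶ Z) :
    ∀ n : ℕ, tpowMap (f ≫ g) n = tpowMap f n ≫ tpowMap g n
  | 0 => (Category.id_comp _).symm
  | n + 1 => by
    change (f ≫ g) ⊗ₘ tpowMap (f ≫ g) n = (f ⊗ₘ tpowMap f n) ≫ (g ⊗ₘ tpowMap g n)
    rw [tpowMap_comp f g n]
    simp

theorem tpowConcat_natural {X Y : C} (f : X ⟶ Y) : ∀ a b : ℕ,
    (tpowMap f a ⊗ₘ tpowMap f b) ≫ tpowConcat Y a b = tpowConcat X a b ≫ tpowMap f (b + a)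
  | 0, b => by
    change (𝟙 (𝟙_ C) ⊗ₘ tpowMap f b) ≫ (λ_ (tpow Y b)).hom = (λ_ (tpow X b)).hom ≫ tpowMap f b
    simp
  | a + 1, b => by
    change ((f ⊗ₘ tpowMap f a) ⊗ₘ tpowMap f b) ≫
        (α_ Y (tpow Y a) (tpow Y b)).hom ≫ Y ◁ tpowConcat Y a b =
      ((α_ X (tpow X a) (tpow X b)).hom ≫ X ◁ tpowConcat X a b) ≫ (f ⊗ₘ tpowMap f (b + a))
    rw [associator_naturality_assoc, ← id_tensorHom, ← id_tensorHom, tensorHom_comp_tensorHom,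
      Category.assoc, tensorHom_comp_tensorHom, tpowConcat_natural f a b]
    simp

variable [SymmetricCategory C]

theorem tpowPull_natural {X Y : C} (f : X ⟶ Y) : ∀ (n : ℕ) (i : Fin (n + 1)),
    tpowPull X n i ≫ (f ⊗ₘ tpowMap f n) = tpowMap f (n + 1) ≫ tpowPull Y n i
  | 0, i => by
    change 𝟙 _ ≫ (f ⊗ₘ tpowMap f 0) = (f ⊗ₘ tpowMap f 0) ≫ 𝟙 _
    simp
  | n + 1, i => by
    refine Fin.cases ?_ (fun j => ?_) i
    · change 𝟙 _ ≫ (f ⊗ₘ tpowMap f (n + 1)) = (f ⊗ₘ tpowMap f (n + 1)) ≫ 𝟙 _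
      simp
    · have h := tpowPull_natural f n j
      change (X ◁ tpowPull X n j ≫ (α_ X X (tpow X n)).inv ≫ (β_ X X).hom ▷ tpow X n ≫
          (α_ X X (tpow X n)).hom) ≫ (f ⊗ₘ (f ⊗ₘ tpowMap f n)) =
        (f ⊗ₘ tpowMap f (n + 1)) ≫ (Y ◁ tpowPull Y n j ≫ (α_ Y Y (tpow Y n)).inv ≫
          (β_ Y Y).hom ▷ tpow Y n ≫ (α_ Y Y (tpow Y n)).hom)
      have h2 : (f ⊗ₘ tpowMap f (n + 1)) ≫ Y ◁ tpowPull Y n j =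
          X ◁ tpowPull X n j ≫ (f ⊗ₘ (f ⊗ₘ tpowMap f n)) := by
        rw [← id_tensorHom, ← id_tensorHom, tensorHom_comp_tensorHom, tensorHom_comp_tensorHom, h]
        simp
      rw [reassoc_of% h2]
      simp only [Category.assoc]
      congr 1
      rw [← associator_naturality, associator_inv_naturality_assoc, ← tensorHom_id,
        ← tensorHom_id, tensorHom_comp_tensorHom_assoc, tensorHom_comp_tensorHom_assoc,
        BraidedCategory.braiding_naturality]
      simp

theorem tpowPerm_natural {X Y : C} (f : X ⟶ Y) : ∀ (n : ℕ) (σ : Equiv.Perm (Fin n)),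
    tpowPerm X n σ ≫ tpowMap f n = tpowMap f n ≫ tpowPerm Y n σ
  | 0, σ => by
    change 𝟙 (𝟙_ C) ≫ 𝟙 (𝟙_ C) = 𝟙 (𝟙_ C) ≫ 𝟙 (𝟙_ C)
    rfl
  | n + 1, σ => by
    change (tpowPull X n (σ 0) ≫ X ◁ tpowPerm X n (permTail σ)) ≫ (f ⊗ₘ tpowMap f n) =
      tpowMap f (n + 1) ≫ tpowPull Y n (σ 0) ≫ Y ◁ tpowPerm Y n (permTail σ)
    rw [← reassoc_of% (tpowPull_natural f n (σ 0)), Category.assoc, ← id_tensorHom,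
      ← id_tensorHom, tensorHom_comp_tensorHom, tensorHom_comp_tensorHom, tpowPerm_natural f n]
    simp

end TensorPowers

/-! ### The Schur functor of an operad -/

section ClosedAdditive

variable {C : Type u} [Category.{v} C] [Abelian C] [MonoidalCategory C] [SymmetricCategory C]
  [MonoidalClosed C]

/-- In a closed symmetric monoidal abelian category, the tensor product is additive in both
variables. -/
theorem monoidalPreadditive_of_closed : MonoidalPreadditive C := by
  have hl : ∀ X : C, (tensorLeft X).Additive := fun X => by
    have := preservesBinaryBiproducts_of_preservesBinaryCoproducts (tensorLeft X)
    exact Functor.additive_of_preservesBinaryBiproducts _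
  have hr : ∀ X : C, (tensorRight X).Additive := fun X => by
    have := preservesBinaryBiproducts_of_preservesBinaryCoproducts (tensorRight X)
    exact Functor.additive_of_preservesBinaryBiproducts _
  exact
    { whiskerLeft_zero := fun {X _ _} => (tensorLeft X).map_zero _ _
      zero_whiskerRight := fun {X _ _} => (tensorRight X).map_zero _ _
      whiskerLeft_add := fun {X _ _} _ _ => (tensorLeft X).map_add
      add_whiskerRight := fun {X _ _} _ _ => (tensorRight X).map_add }

end ClosedAdditive

attribute [local instance] monoidalPreadditive_of_closed

namespace SymOperad

set_option linter.unusedSectionVars false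

section Schur

variable {C : Type u} [Category.{v} C] [Abelian C] [HasColimits C] [MonoidalCategory C]
  [SymmetricCategory C] [MonoidalClosed C] (P : SymOperad C)

/-- The object of coinvariants `P_n ⊗_{Σ_n} W`, for an object `W` on which the permutations of
`Fin n` act by `a`: the quotient of `P_n ⊗ W` identifying `σ p ⊗ w` with `p ⊗ a σ w`. -/
noncomputable def coinv {n : ℕ} {W : C} (a : Equiv.Perm (Fin n) → (W ⟶ W)) : C :=
  cokernel (Sigma.desc fun σ : Equiv.Perm (Fin n) => P.map σ ▷ W - P.obj (Fin n) ◁ a σ)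

/-- The quotient morphism `P_n ⊗ W ⟶ P_n ⊗_{Σ_n} W`. -/
noncomputable def coinvProj {n : ℕ} {W : C} (a : Equiv.Perm (Fin n) → (W ⟶ W)) :
    P.obj (Fin n) ⊗ W ⟶ P.coinv a :=
  cokernel.π _

theorem coinvProj_condition {n : ℕ} {W : C} (a : Equiv.Perm (Fin n) → (W ⟶ W))
    (σ : Equiv.Perm (Fin n)) :
    P.map σ ▷ W ≫ P.coinvProj a = P.obj (Fin n) ◁ a σ ≫ P.coinvProj a := by
  rw [← sub_eq_zero, ← Preadditive.sub_comp]
  have h := cokernel.condition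
    (Sigma.desc fun σ : Equiv.Perm (Fin n) => P.map σ ▷ W - P.obj (Fin n) ◁ a σ)
  have h2 := congrArg (fun z => Sigma.ι (fun _ : Equiv.Perm (Fin n) => P.obj (Fin n) ⊗ W) σ ≫ z) h
  rw [colimit.ι_desc_assoc, comp_zero] at h2
  exact h2

theorem coinv_hom_ext {n : ℕ} {W Z : C} {a : Equiv.Perm (Fin n) → (W ⟶ W)}
    {f g : P.coinv a ⟶ Z} (h : P.coinvProj a ≫ f = P.coinvProj a ≫ g) : f = g :=
  coequalizer.hom_ext h

/-- The morphism induced on coinvariants by an equivariant morphism. -/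
noncomputable def coinvMap {n : ℕ} {W W' : C} {a : Equiv.Perm (Fin n) → (W ⟶ W)}
    {a' : Equiv.Perm (Fin n) → (W' ⟶ W')} (f : W ⟶ W') (h : ∀ σ, a σ ≫ f = f ≫ a' σ) :
    P.coinv a ⟶ P.coinv a' :=
  cokernel.desc _ (P.obj (Fin n) ◁ f ≫ P.coinvProj a') (by
    refine Sigma.hom_ext _ _ fun σ => ?_
    rw [colimit.ι_desc_assoc, comp_zero]
    change (P.map σ ▷ W - P.obj (Fin n) ◁ a σ) ≫ P.obj (Fin n) ◁ f ≫ P.coinvProj a' = 0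
    rw [Preadditive.sub_comp, sub_eq_zero, ← whisker_exchange_assoc, coinvProj_condition,
      ← whiskerLeft_comp_assoc, ← whiskerLeft_comp_assoc, h])

@[simp]
theorem coinvProj_map {n : ℕ} {W W' : C} {a : Equiv.Perm (Fin n) → (W ⟶ W)}
    {a' : Equiv.Perm (Fin n) → (W' ⟶ W')} (f : W ⟶ W') (h : ∀ σ, a σ ≫ f = f ≫ a' σ) :
    P.coinvProj a ≫ P.coinvMap f h = P.obj (Fin n) ◁ f ≫ P.coinvProj a' :=
  cokernel.π_desc _ _ _

@[simp]
theorem coinvProj_map_assoc {n : ℕ} {W W' Z : C} {a : Equiv.Perm (Fin n) → (W ⟶ W)}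
    {a' : Equiv.Perm (Fin n) → (W' ⟶ W')} (f : W ⟶ W') (h : ∀ σ, a σ ≫ f = f ≫ a' σ)
    (z : P.coinv a' ⟶ Z) :
    P.coinvProj a ≫ P.coinvMap f h ≫ z = P.obj (Fin n) ◁ f ≫ P.coinvProj a' ≫ z := by
  rw [← Category.assoc, coinvProj_map, Category.assoc]

/-- The Schur functor `P(X) = ⨁_n P_n ⊗_{Σ_n} X^{⊗ n}`. -/
noncomputable def schur : C ⥤ C where
  obj X := ∐ fun n : ℕ => P.coinv (tpowPerm X n)
  map f := Limits.Sigma.map fun n => P.coinvMap (tpowMap f n) (tpowPerm_natural f n)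
  map_id X := by
    refine Sigma.hom_ext _ _ fun n => P.coinv_hom_ext ?_
    simp [tpowMap_id]
  map_comp f g := by
    refine Sigma.hom_ext _ _ fun n => P.coinv_hom_ext ?_
    simp [tpowMap_comp]

/-- The canonical morphism `P_n ⊗ X^{⊗ n} ⟶ P(X)`. -/
noncomputable def toSchur (X : C) (n : ℕ) : P.obj (Fin n) ⊗ tpow X n ⟶ P.schur.obj X :=
  P.coinvProj (tpowPerm X n) ≫ Sigma.ι (fun n : ℕ => P.coinv (tpowPerm X n)) n

theorem toSchur_map {X Y : C} (f : X ⟶ Y) (n : ℕ) :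
    P.toSchur X n ≫ P.schur.map f = P.obj (Fin n) ◁ tpowMap f n ≫ P.toSchur Y n := by
  simp [toSchur, schur]

theorem schur_hom_ext {X Z : C} {f g : P.schur.obj X ⟶ Z}
    (h : ∀ n, P.toSchur X n ≫ f = P.toSchur X n ≫ g) : f = g := by
  refine Sigma.hom_ext _ _ fun n => P.coinv_hom_ext ?_
  exact (Category.assoc _ _ _).symm.trans ((h n).trans (Category.assoc _ _ _))

/-- The isomorphism `X ⟶ X^{⊗ 1}`. -/
def tpowOneInsert (X : C) : X ⟶ tpow X 1 :=
  (ρ_ X).inv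

/-- The unit `X ⟶ P(X)`, given by the identity operation. -/
noncomputable def schurUnit (X : C) : X ⟶ P.schur.obj X :=
  (λ_ X).inv ≫ ((P.one ≫ P.map (Equiv.ofUnique Unit (Fin 1))) ⊗ₘ tpowOneInsert X) ≫ P.toSchur X 1

/-- The morphism `⨂_i (P_{k_i} ⊗ Z^{⊗ k_i}) ⟶ P(Z)^{⊗ n}`, for `k = [k_1, …, k_n]`. -/
noncomputable def blocksToPow (Z : C) :
    (k : List ℕ) → (P.blocks Z k ⟶ tpow (P.schur.obj Z) k.length)
  | [] => 𝟙 (𝟙_ C)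
  | m :: k => P.toSchur Z m ⊗ₘ blocksToPow Z k

/-- The canonical morphism `P_n ⊗ ⨂_i (P_{k_i} ⊗ Z^{⊗ k_i}) ⟶ P(P(Z))`, for `k = [k_1, …, k_n]`.
As the tensor product commutes with colimits, these morphisms are jointly epimorphic. -/
noncomputable def nested (Z : C) (k : List ℕ) :
    P.obj (Fin k.length) ⊗ P.blocks Z k ⟶ P.schur.obj (P.schur.obj Z) :=
  P.obj (Fin k.length) ◁ P.blocksToPow Z k ≫ P.toSchur (P.schur.obj Z) k.length

/-- The multiplication `P(P(Z)) ⟶ P(Z)` of the monad of the operad, restricted along the morphisms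
`nested`. -/
noncomputable def nestedMul (Z : C) (k : List ℕ) :
    P.obj (Fin k.length) ⊗ P.blocks Z k ⟶ P.schur.obj Z :=
  P.gamma Z k ≫ P.toSchur Z (blocksTotal k 0)

/-- The morphism induced by `f : Z ⟶ Z'` on blocks of arguments. -/
def blocksMap {Z Z' : C} (f : Z ⟶ Z') : (k : List ℕ) → (P.blocks Z k ⟶ P.blocks Z' k)
  | [] => 𝟙 (𝟙_ C)
  | m :: k => (P.obj (Fin m) ◁ tpowMap f m) ⊗ₘ blocksMap f k

theorem blocksToPow_natural {Z Z' : C} (f : Z ⟶ Z') : ∀ k : List ℕ,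
    P.blocksMap f k ≫ P.blocksToPow Z' k =
      P.blocksToPow Z k ≫ tpowMap (P.schur.map f) k.length
  | [] => rfl
  | m :: k => by
    change (_ ⊗ₘ P.blocksMap f k) ≫ (P.toSchur Z' m ⊗ₘ P.blocksToPow Z' k) =
      (P.toSchur Z m ⊗ₘ P.blocksToPow Z k) ≫
        (P.schur.map f ⊗ₘ tpowMap (P.schur.map f) k.length)
    rw [tensorHom_comp_tensorHom, tensorHom_comp_tensorHom, toSchur_map,
      blocksToPow_natural f k]

theorem nested_natural {Z Z' : C} (f : Z ⟶ Z') (k : List ℕ) :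
    P.nested Z k ≫ P.schur.map (P.schur.map f) =
      P.obj (Fin k.length) ◁ P.blocksMap f k ≫ P.nested Z' k := by
  simp only [nested, Category.assoc, toSchur_map, ← whiskerLeft_comp_assoc,
    blocksToPow_natural]

theorem plugStep_natural {O O' O'' W Z V M R W' Z' V' R' : C} (h : O ⟶ O') (c : O' ⊗ M ⟶ O'')
    {cc : W ⊗ Z ⟶ V} {cc' : W' ⊗ Z' ⟶ V'} {w : W ⟶ W'} {z : Z ⟶ Z'} {y : V ⟶ V'} {r : R ⟶ R'}
    (hc : (w ⊗ₘ z) ≫ cc' = cc ≫ y) :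
    plugStep R h c cc ≫ O'' ◁ (y ⊗ₘ r) =
      O ◁ (w ⊗ₘ ((M ◁ z) ⊗ₘ r)) ≫ plugStep R' h c cc' := by
  have key : (W ◁ (α_ M Z R).hom ≫ (α_ W M (Z ⊗ R)).inv ≫ (β_ W M).hom ▷ (Z ⊗ R) ≫
        (α_ M W (Z ⊗ R)).hom ≫ M ◁ ((α_ W Z R).inv ≫ cc ▷ R)) ≫ M ◁ (y ⊗ₘ r) =
      (w ⊗ₘ ((M ◁ z) ⊗ₘ r)) ≫ (W' ◁ (α_ M Z' R').hom ≫ (α_ W' M (Z' ⊗ R')).inv ≫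
        (β_ W' M).hom ▷ (Z' ⊗ R') ≫ (α_ M W' (Z' ⊗ R')).hom ≫
        M ◁ ((α_ W' Z' R').inv ≫ cc' ▷ R')) := by
    have e1 : cc ▷ R ≫ (y ⊗ₘ r) = ((w ⊗ₘ z) ⊗ₘ r) ≫ cc' ▷ R' := by
      rw [← tensorHom_id, ← tensorHom_id, tensorHom_comp_tensorHom, tensorHom_comp_tensorHom, hc]
      simp
    have e2 : (α_ M W (Z ⊗ R)).hom ≫ M ◁ (w ⊗ₘ (z ⊗ₘ r)) =
        ((M ◁ w) ⊗ₘ (z ⊗ₘ r)) ≫ (α_ M W' (Z' ⊗ R')).hom := by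
      rw [← id_tensorHom, ← id_tensorHom, associator_naturality]
    have e3 : (β_ W M).hom ▷ (Z ⊗ R) ≫ ((M ◁ w) ⊗ₘ (z ⊗ₘ r)) =
        ((w ▷ M) ⊗ₘ (z ⊗ₘ r)) ≫ (β_ W' M).hom ▷ (Z' ⊗ R') := by
      rw [← tensorHom_id, ← tensorHom_id (β_ W' M).hom, tensorHom_comp_tensorHom,
        tensorHom_comp_tensorHom, BraidedCategory.braiding_naturality_left]
      simp
    have e4 : (α_ W M (Z ⊗ R)).inv ≫ ((w ▷ M) ⊗ₘ (z ⊗ₘ r)) =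
        (w ⊗ₘ (M ◁ (z ⊗ₘ r))) ≫ (α_ W' M (Z' ⊗ R')).inv := by
      rw [← tensorHom_id, ← id_tensorHom, associator_inv_naturality]
    have e5 : W ◁ (α_ M Z R).hom ≫ (w ⊗ₘ (M ◁ (z ⊗ₘ r))) =
        (w ⊗ₘ ((M ◁ z) ⊗ₘ r)) ≫ W' ◁ (α_ M Z' R').hom := by
      rw [← id_tensorHom W, ← id_tensorHom W', tensorHom_comp_tensorHom,
        tensorHom_comp_tensorHom, ← id_tensorHom, ← id_tensorHom, associator_naturality]
      simp
    simp only [Category.assoc, ← whiskerLeft_comp, e1]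
    rw [← associator_inv_naturality_assoc, whiskerLeft_comp, reassoc_of% e2, reassoc_of% e3,
      reassoc_of% e4, reassoc_of% e5]
  have e6 : (α_ O' M (V ⊗ R)).inv ≫ c ▷ (V ⊗ R) ≫ O'' ◁ (y ⊗ₘ r) =
      O' ◁ M ◁ (y ⊗ₘ r) ≫ (α_ O' M (V' ⊗ R')).inv ≫ c ▷ (V' ⊗ R') := by
    rw [← whisker_exchange]
    simp
  rw [plugStep, plugStep, Category.assoc, Category.assoc, e6, ← id_tensorHom O',
    tensorHom_comp_tensorHom_assoc, key, ← id_tensorHom O, tensorHom_comp_tensorHom_assoc]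
  simp only [Category.comp_id, Category.id_comp]

theorem gammaAux_natural {Z Z' : C} (f : Z ⟶ Z') : ∀ (k : List ℕ) (a : ℕ),
    P.gammaAux Z k a ≫ P.obj _ ◁ tpowMap f (blocksTotal k a) =
      P.obj (Fin k.length ⊕ Fin a) ◁ (tpowMap f a ⊗ₘ P.blocksMap f k) ≫ P.gammaAux Z' k a
  | [], a => by
    change (P.map (Equiv.emptySum (Fin 0) (Fin a)) ⊗ₘ (ρ_ (tpow Z a)).hom) ≫
        P.obj (Fin a) ◁ tpowMap f a =
      P.obj (Fin 0 ⊕ Fin a) ◁ (tpowMap f a ⊗ₘ 𝟙 (𝟙_ C)) ≫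
        (P.map (Equiv.emptySum (Fin 0) (Fin a)) ⊗ₘ (ρ_ (tpow Z' a)).hom)
    rw [← id_tensorHom, ← id_tensorHom, tensorHom_comp_tensorHom, tensorHom_comp_tensorHom,
      tensorHom_id, rightUnitor_naturality]
    simp
  | m :: k, a => by
    exact (Category.assoc _ _ _).trans ((congrArg (fun x => _ ≫ x)
      (gammaAux_natural f k (m + a))).trans ((Category.assoc _ _ _).symm.trans
      ((congrArg (fun x => x ≫ _) (plugStep_natural _ _ (tpowConcat_natural f a m))).trans
      (Category.assoc _ _ _))))

theorem tpowZeroInsert_natural {Z Z' R R' : C} (f : Z ⟶ Z') (r : R ⟶ R') :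
    tpowZeroInsert Z R ≫ (tpowMap f 0 ⊗ₘ r) = r ≫ tpowZeroInsert Z' R' := by
  change (λ_ R).inv ≫ (𝟙 (𝟙_ C) ⊗ₘ r) = r ≫ (λ_ R').inv
  simp

theorem gamma_natural {Z Z' : C} (f : Z ⟶ Z') (k : List ℕ) :
    P.gamma Z k ≫ P.obj _ ◁ tpowMap f (blocksTotal k 0) =
      P.obj (Fin k.length) ◁ P.blocksMap f k ≫ P.gamma Z' k := by
  rw [gamma, gamma, Category.assoc, gammaAux_natural, ← id_tensorHom, ← id_tensorHom,
    tensorHom_comp_tensorHom_assoc, tensorHom_comp_tensorHom_assoc, tpowZeroInsert_natural]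
  simp

theorem nestedMul_natural {Z Z' : C} (f : Z ⟶ Z') (k : List ℕ) :
    P.nestedMul Z k ≫ P.schur.map f =
      P.obj (Fin k.length) ◁ P.blocksMap f k ≫ P.nestedMul Z' k := by
  rw [nestedMul, nestedMul, Category.assoc, toSchur_map, ← Category.assoc, gamma_natural,
    Category.assoc]

/-! ### The relative Schur construction `P ∘ (B | X)` -/

/-- The quotient `(X ⊕ B)^{⊗ n} / B^{⊗ n}`. -/
noncomputable def relPow (B X : C) (n : ℕ) : C :=
  cokernel (tpowMap (biprod.inr : B ⟶ X ⊞ B) n)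

/-- The quotient morphism `(X ⊕ B)^{⊗ n} ⟶ (X ⊕ B)^{⊗ n} / B^{⊗ n}`. -/
noncomputable def relPowProj (B X : C) (n : ℕ) : tpow (X ⊞ B) n ⟶ relPow B X n :=
  cokernel.π _

instance (B X : C) (n : ℕ) : Epi (relPowProj B X n) :=
  inferInstanceAs (Epi (cokernel.π _))

/-- The morphism out of the quotient induced by a morphism which vanishes on `B^{⊗ n}`. -/
noncomputable def relPowDesc {B X Z : C} {n : ℕ} (f : tpow (X ⊞ B) n ⟶ Z)
    (h : tpowMap (biprod.inr : B ⟶ X ⊞ B) n ≫ f = 0) : relPow B X n ⟶ Z :=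
  cokernel.desc _ f h

@[simp]
theorem relPowProj_desc {B X Z : C} {n : ℕ} (f : tpow (X ⊞ B) n ⟶ Z)
    (h : tpowMap (biprod.inr : B ⟶ X ⊞ B) n ≫ f = 0) :
    relPowProj B X n ≫ relPowDesc f h = f :=
  cokernel.π_desc _ _ _

@[simp]
theorem relPow_condition (B X : C) (n : ℕ) :
    tpowMap (biprod.inr : B ⟶ X ⊞ B) n ≫ relPowProj B X n = 0 :=
  cokernel.condition _

/-- The action of the permutations on the quotient `(X ⊕ B)^{⊗ n} / B^{⊗ n}`. -/
noncomputable def relPowPerm (B X : C) (n : ℕ) (σ : Equiv.Perm (Fin n)) :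
    relPow B X n ⟶ relPow B X n :=
  relPowDesc (tpowPerm (X ⊞ B) n σ ≫ relPowProj B X n) (by
    rw [← Category.assoc, ← tpowPerm_natural, Category.assoc, relPow_condition, comp_zero])

theorem relPowProj_perm (B X : C) (n : ℕ) (σ : Equiv.Perm (Fin n)) :
    tpowPerm (X ⊞ B) n σ ≫ relPowProj B X n = relPowProj B X n ≫ relPowPerm B X n σ :=
  (relPowProj_desc _ _).symm

/-- `P ∘ (B | X) = ⨁_n P_n ⊗_{Σ_n} ((X ⊕ B)^{⊗ n} / B^{⊗ n})`. -/
noncomputable def rel (B X : C) : C :=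
  ∐ fun n : ℕ => P.coinv (relPowPerm B X n)

/-- The projection `P(X ⊕ B) ⟶ P ∘ (B | X)`. -/
noncomputable def relProj (B X : C) : P.schur.obj (X ⊞ B) ⟶ P.rel B X :=
  Limits.Sigma.map fun n => P.coinvMap (relPowProj B X n) (relPowProj_perm B X n)

/-- The morphism `1 - e^{⊗ n}` of `(X ⊕ B)^{⊗ n}`, where `e` is the projector of `X ⊕ B` onto `B`,
induces a section of the projection of `(X ⊕ B)^{⊗ n}` onto its quotient by `B^{⊗ n}`. -/
noncomputable def relPowIncl (B X : C) (n : ℕ) : relPow B X n ⟶ tpow (X ⊞ B) n :=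
  relPowDesc (𝟙 _ - tpowMap (biprod.snd ≫ biprod.inr) n) (by
    rw [Preadditive.comp_sub, ← tpowMap_comp]
    simp)

theorem relPowIncl_perm (B X : C) (n : ℕ) (σ : Equiv.Perm (Fin n)) :
    relPowPerm B X n σ ≫ relPowIncl B X n = relPowIncl B X n ≫ tpowPerm (X ⊞ B) n σ := by
  rw [← cancel_epi (relPowProj B X n), ← Category.assoc, ← relPowProj_perm, Category.assoc,
    ← Category.assoc (relPowProj B X n)]
  simp only [relPowIncl, relPowProj_desc, Preadditive.comp_sub, Preadditive.sub_comp,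
    tpowPerm_natural, Category.comp_id, Category.id_comp]

/-- The inclusion `P ∘ (B | X) ⟶ P(X ⊕ B)` of the summand complementary to `P(B)`. -/
noncomputable def relIncl (B X : C) : P.rel B X ⟶ P.schur.obj (X ⊞ B) :=
  Limits.Sigma.map fun n => P.coinvMap (relPowIncl B X n) (relPowIncl_perm B X n)

/-- The morphism induced by `f` and `g` on the quotients `(X ⊕ B)^{⊗ n} / B^{⊗ n}`. -/
noncomputable def relPowMap {B B' X X' : C} (g : B ⟶ B') (f : X ⟶ X') (n : ℕ) :
    relPow B X n ⟶ relPow B' X' n :=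
  relPowDesc (tpowMap (biprod.map f g) n ≫ relPowProj B' X' n) (by
    rw [← Category.assoc, ← tpowMap_comp, biprod.inr_map, tpowMap_comp, Category.assoc,
      relPow_condition, comp_zero])

theorem relPowMap_perm {B B' X X' : C} (g : B ⟶ B') (f : X ⟶ X') (n : ℕ)
    (σ : Equiv.Perm (Fin n)) :
    relPowPerm B X n σ ≫ relPowMap g f n = relPowMap g f n ≫ relPowPerm B' X' n σ := by
  rw [← cancel_epi (relPowProj B X n), ← Category.assoc, ← relPowProj_perm, Category.assoc,
    ← Category.assoc (relPowProj B X n), relPowMap, relPowProj_desc, Category.assoc,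
    ← relPowProj_perm, ← Category.assoc, ← Category.assoc, tpowPerm_natural]

/-- The morphism `P ∘ (g | f) : P ∘ (B | X) ⟶ P ∘ (B' | X')`. -/
noncomputable def relMap {B B' X X' : C} (g : B ⟶ B') (f : X ⟶ X') : P.rel B X ⟶ P.rel B' X' :=
  Limits.Sigma.map fun n => P.coinvMap (relPowMap g f n) (relPowMap_perm g f n)

/-- The canonical morphism `P_n ⊗ ((X ⊕ B)^{⊗ n} / B^{⊗ n}) ⟶ P ∘ (B | X)`. -/
noncomputable def toRel (B X : C) (n : ℕ) : P.obj (Fin n) ⊗ relPow B X n ⟶ P.rel B X :=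
  P.coinvProj (relPowPerm B X n) ≫ Sigma.ι (fun n : ℕ => P.coinv (relPowPerm B X n)) n

theorem toSchur_relProj (B X : C) (n : ℕ) :
    P.toSchur (X ⊞ B) n ≫ P.relProj B X = P.obj (Fin n) ◁ relPowProj B X n ≫ P.toRel B X n := by
  change (P.coinvProj (tpowPerm (X ⊞ B) n) ≫
    Sigma.ι (fun n : ℕ => P.coinv (tpowPerm (X ⊞ B) n)) n) ≫ Limits.Sigma.map _ = _ ≫ _ ≫ _
  simp

theorem toRel_relIncl (B X : C) (n : ℕ) :
    P.toRel B X n ≫ P.relIncl B X =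
      P.obj (Fin n) ◁ relPowIncl B X n ≫ P.toSchur (X ⊞ B) n := by
  change (P.coinvProj (relPowPerm B X n) ≫
    Sigma.ι (fun n : ℕ => P.coinv (relPowPerm B X n)) n) ≫ Limits.Sigma.map _ = _ ≫ _ ≫ _
  simp

theorem toRel_relMap {B B' X X' : C} (g : B ⟶ B') (f : X ⟶ X') (n : ℕ) :
    P.toRel B X n ≫ P.relMap g f = P.obj (Fin n) ◁ relPowMap g f n ≫ P.toRel B' X' n := by
  change (P.coinvProj (relPowPerm B X n) ≫
    Sigma.ι (fun n : ℕ => P.coinv (relPowPerm B X n)) n) ≫ Limits.Sigma.map _ = _ ≫ _ ≫ _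
  simp

theorem rel_hom_ext {B X Z : C} {f g : P.rel B X ⟶ Z}
    (h : ∀ n, P.toRel B X n ≫ f = P.toRel B X n ≫ g) : f = g := by
  refine Sigma.hom_ext _ _ fun n => P.coinv_hom_ext ?_
  exact (Category.assoc _ _ _).symm.trans ((h n).trans (Category.assoc _ _ _))

theorem relProj_relIncl (B X : C) :
    P.relProj B X ≫ P.relIncl B X = 𝟙 _ - P.schur.map (biprod.snd ≫ biprod.inr) := by
  refine P.schur_hom_ext fun n => ?_
  rw [reassoc_of% (toSchur_relProj P), toRel_relIncl, ← whiskerLeft_comp_assoc, relPowIncl,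
    relPowProj_desc, Preadditive.comp_sub, toSchur_map, Category.comp_id]
  have h := (tensorLeft (P.obj (Fin n))).map_sub (f := 𝟙 (tpow (X ⊞ B) n))
    (g := tpowMap (biprod.snd ≫ biprod.inr) n)
  change P.obj (Fin n) ◁ (_ - _) = P.obj (Fin n) ◁ 𝟙 _ - P.obj (Fin n) ◁ _ at h
  rw [h, Preadditive.sub_comp, whiskerLeft_id, Category.id_comp]

theorem relPowProj_incl (B X : C) (n : ℕ) :
    relPowIncl B X n ≫ relPowProj B X n = 𝟙 _ := by
  rw [← cancel_epi (relPowProj B X n), relPowIncl, reassoc_of% relPowProj_desc, Preadditive.sub_comp,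
    tpowMap_comp, Category.assoc, relPow_condition]
  simp

@[simp]
theorem relIncl_relProj (B X : C) : P.relIncl B X ≫ P.relProj B X = 𝟙 _ := by
  refine P.rel_hom_ext fun n => ?_
  rw [reassoc_of% (toRel_relIncl P), toSchur_relProj, ← whiskerLeft_comp_assoc, relPowProj_incl]
  simp

instance (B X : C) : Epi (P.relProj B X) :=
  epi_of_epi_fac (P.relIncl_relProj B X)

@[simp]
theorem schur_inr_relProj (B X : C) :
    P.schur.map (biprod.inr : B ⟶ X ⊞ B) ≫ P.relProj B X = 0 := by
  refine P.schur_hom_ext fun n => ?_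
  rw [reassoc_of% (toSchur_map P), toSchur_relProj, ← whiskerLeft_comp_assoc, relPow_condition]
  simp

@[simp]
theorem relIncl_schur_snd (B X : C) :
    P.relIncl B X ≫ P.schur.map (biprod.snd : X ⊞ B ⟶ B) = 0 := by
  rw [← cancel_epi (P.relProj B X), reassoc_of% (relProj_relIncl P), Preadditive.sub_comp,
    ← Functor.map_comp]
  simp

theorem relProj_map {B B' X X' : C} (g : B ⟶ B') (f : X ⟶ X') :
    P.relProj B X ≫ P.relMap g f = P.schur.map (biprod.map f g) ≫ P.relProj B' X' := by
  refine P.schur_hom_ext fun n => ?_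
  rw [reassoc_of% (toSchur_relProj P), toRel_relMap, reassoc_of% (toSchur_map P), toSchur_relProj,
    ← whiskerLeft_comp_assoc, ← whiskerLeft_comp_assoc, relPowMap, relPowProj_desc]

theorem schurUnit_natural {X Y : C} (f : X ⟶ Y) :
    P.schurUnit X ≫ P.schur.map f = f ≫ P.schurUnit Y := by
  have h : tpowOneInsert X ≫ tpowMap f 1 = f ≫ tpowOneInsert Y := by
    change (ρ_ X).inv ≫ (f ⊗ₘ 𝟙 (𝟙_ C)) = f ≫ (ρ_ Y).inv
    rw [tensorHom_id, rightUnitor_inv_naturality]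
  have h2 : ((P.one ≫ P.map (Equiv.ofUnique Unit (Fin 1))) ⊗ₘ (f ≫ tpowOneInsert Y)) =
      𝟙_ C ◁ f ≫ ((P.one ≫ P.map (Equiv.ofUnique Unit (Fin 1))) ⊗ₘ tpowOneInsert Y) := by
    rw [← id_tensorHom, tensorHom_comp_tensorHom, Category.id_comp]
  rw [schurUnit, schurUnit, Category.assoc, Category.assoc, toSchur_map, ← id_tensorHom,
    tensorHom_comp_tensorHom_assoc, h, Category.comp_id, h2, Category.assoc,
    leftUnitor_inv_naturality_assoc]




/-! ### Algebras over an operad -/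

/-- An algebra over the operad `P`: an object with a structure morphism `P(X) ⟶ X` which is unital
and associative. The associativity square, whose source is `P(P(X))`, is tested on the jointly
epimorphic morphisms `P_n ⊗ ⨂_i (P_{k_i} ⊗ X^{⊗ k_i}) ⟶ P(P(X))`. -/
structure Alg where
  carrier : C
  str : P.schur.obj carrier ⟶ carrier
  unit_str : P.schurUnit carrier ≫ str = 𝟙 carrier
  assoc_str (k : List ℕ) :
    P.nested carrier k ≫ P.schur.map str ≫ str = P.nestedMul carrier k ≫ str

namespace Alg

variable {P}

/-- Morphisms of algebras. -/
@[ext]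
structure Hom (X Y : P.Alg) where
  hom : X.carrier ⟶ Y.carrier
  str_hom : X.str ≫ hom = P.schur.map hom ≫ Y.str

instance : Category P.Alg where
  Hom := Hom
  id X := { hom := 𝟙 _, str_hom := by simp }
  comp f g :=
    { hom := f.hom ≫ g.hom
      str_hom := by rw [Functor.map_comp, Category.assoc, reassoc_of% f.str_hom, g.str_hom] }

@[ext]
theorem hom_ext {X Y : P.Alg} {f g : X ⟶ Y} (h : f.hom = g.hom) : f = g :=
  Hom.ext h

@[simp] theorem id_hom (X : P.Alg) : (𝟙 X : X ⟶ X).hom = 𝟙 X.carrier := rfl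

@[simp] theorem comp_hom {X Y Z : P.Alg} (f : X ⟶ Y) (g : Y ⟶ Z) :
    (f ≫ g).hom = f.hom ≫ g.hom := rfl

end Alg

/-- The operad is reduced: `P_0 = 0`, and `P_1` is the unit of the tensor product. -/
class IsReduced : Prop where
  isZero_zero : IsZero (P.obj (Fin 0))
  isIso_one : IsIso P.one

/-! ### Internal actions -/

/-- `ρ : P ∘ (B | X) ⟶ X` is an internal action of the algebra `B` on the algebra `X`. -/
structure IsAction (B X : P.Alg) (ρ : P.rel B.carrier X.carrier ⟶ X.carrier) : Prop where
  /-- The composition of `P(X) ⟶ P ∘ (B | X)` with the action is the structure morphism of `X`. -/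
  compat : (P.schur.map biprod.inl ≫ P.relProj B.carrier X.carrier) ≫ ρ = X.str
  /-- The two morphisms `P ∘ (P(B) | P ∘ (B | X)) ⟶ X`, given by `P ∘ (μ_B | ρ)` and by the
  multiplication of the operad, followed by `ρ`, agree. This is tested on the jointly epimorphic
  morphisms `P_n ⊗ ⨂_i (P_{k_i} ⊗ (X ⊕ B)^{⊗ k_i}) ⟶ P(P(X ⊕ B)) ≅ P(P ∘ (B | X) ⊕ P(B)) ⟶
  P ∘ (P(B) | P ∘ (B | X))`. -/
  assoc (k : List ℕ) :
    P.nested (X.carrier ⊞ B.carrier) k ≫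
      P.schur.map (biprod.lift (P.relProj B.carrier X.carrier) (P.schur.map biprod.snd)) ≫
      P.relProj (P.schur.obj B.carrier) (P.rel B.carrier X.carrier) ≫
      P.relMap B.str ρ ≫ ρ =
    P.nestedMul (X.carrier ⊞ B.carrier) k ≫ P.relProj B.carrier X.carrier ≫ ρ

/-- The natural action of an algebra `B` on itself,
`P ∘ (B | B) ⟶ P(B ⊕ B) ⟶ P(B) ⟶ B`. -/
noncomputable def selfAction (B : P.Alg) : P.rel B.carrier B.carrier ⟶ B.carrier :=
  P.relIncl B.carrier B.carrier ≫ P.schur.map (biprod.desc (𝟙 _) (𝟙 _)) ≫ B.str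

/-- The objects of the category of internal actions. -/
structure Act where
  B : P.Alg
  X : P.Alg
  ρ : P.rel B.carrier X.carrier ⟶ X.carrier
  isAction : P.IsAction B X ρ

namespace Act

variable {P}

/-- Morphisms of internal actions. -/
@[ext]
structure Hom (a a' : P.Act) where
  g : a.B ⟶ a'.B
  f : a.X ⟶ a'.X
  ρ_comm : a.ρ ≫ f.hom = P.relMap g.hom f.hom ≫ a'.ρ

theorem relMap_id (B X : C) : P.relMap (𝟙 B) (𝟙 X) = 𝟙 _ := by
  have h : biprod.map (𝟙 X) (𝟙 B) = 𝟙 (X ⊞ B) := by ext <;> simp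
  rw [← cancel_epi (P.relProj B X), relProj_map, h]
  simp

theorem relMap_comp {B B' B'' X X' X'' : C} (g : B ⟶ B') (g' : B' ⟶ B'') (f : X ⟶ X')
    (f' : X' ⟶ X'') : P.relMap (g ≫ g') (f ≫ f') = P.relMap g f ≫ P.relMap g' f' := by
  have h : biprod.map (f ≫ f') (g ≫ g') = biprod.map f g ≫ biprod.map f' g' := by
    ext <;> simp
  rw [← cancel_epi (P.relProj B X), relProj_map, reassoc_of% (relProj_map P), relProj_map, h]
  simp

instance : Category P.Act where
  Hom := Hom
  id a := { g := 𝟙 _, f := 𝟙 _, ρ_comm := by simp [relMap_id] }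
  comp u w :=
    { g := u.g ≫ w.g
      f := u.f ≫ w.f
      ρ_comm := by
        rw [Alg.comp_hom, Alg.comp_hom, relMap_comp, Category.assoc, ← w.ρ_comm,
          ← Category.assoc, u.ρ_comm, Category.assoc] }

@[ext]
theorem hom_ext {a a' : P.Act} {u w : a ⟶ a'} (hg : u.g = w.g) (hf : u.f = w.f) : u = w :=
  Hom.ext hg hf

@[simp] theorem id_g (a : P.Act) : (𝟙 a : a ⟶ a).g = 𝟙 a.B := rfl
@[simp] theorem id_f (a : P.Act) : (𝟙 a : a ⟶ a).f = 𝟙 a.X := rfl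

@[simp] theorem comp_g {a b c : P.Act} (u : a ⟶ b) (w : b ⟶ c) : (u ≫ w).g = u.g ≫ w.g := rfl
@[simp] theorem comp_f {a b c : P.Act} (u : a ⟶ b) (w : b ⟶ c) : (u ≫ w).f = u.f ≫ w.f := rfl

end Act

/-! ### Split short exact sequences -/

/-- A split short exact sequence `0 ⟶ X ⟶ E ⟶ B ⟶ 0` of algebras, with its section. -/
structure SplitExt where
  X : P.Alg
  E : P.Alg
  B : P.Alg
  i : X ⟶ E
  p : E ⟶ B
  s : B ⟶ E
  s_p : s ≫ p = 𝟙 B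
  zero : i.hom ≫ p.hom = 0
  exact : (ShortComplex.mk i.hom p.hom zero).ShortExact

namespace SplitExt

variable {P}

/-- Morphisms of split short exact sequences. -/
@[ext]
structure Hom (S S' : P.SplitExt) where
  fX : S.X ⟶ S'.X
  fE : S.E ⟶ S'.E
  fB : S.B ⟶ S'.B
  i_comm : S.i ≫ fE = fX ≫ S'.i
  p_comm : S.p ≫ fB = fE ≫ S'.p
  s_comm : S.s ≫ fE = fB ≫ S'.s

instance : Category P.SplitExt where
  Hom := Hom
  id S := { fX := 𝟙 _, fE := 𝟙 _, fB := 𝟙 _, i_comm := by simp, p_comm := by simp,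
            s_comm := by simp }
  comp u w :=
    { fX := u.fX ≫ w.fX
      fE := u.fE ≫ w.fE
      fB := u.fB ≫ w.fB
      i_comm := by rw [← Category.assoc, u.i_comm, Category.assoc, w.i_comm, Category.assoc]
      p_comm := by rw [← Category.assoc, u.p_comm, Category.assoc, w.p_comm, Category.assoc]
      s_comm := by rw [← Category.assoc, u.s_comm, Category.assoc, w.s_comm, Category.assoc] }

@[ext]
theorem hom_ext {S S' : P.SplitExt} {u w : S ⟶ S'} (hX : u.fX = w.fX) (hE : u.fE = w.fE)
    (hB : u.fB = w.fB) : u = w :=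
  Hom.ext hX hE hB

end SplitExt

/-! ### Precrossed modules -/

/-- A precrossed module: an action of `B` on `X` with a `B`-equivariant morphism `d : X ⟶ B`, for
the natural action of `B` on itself. -/
structure PXMod where
  act : P.Act
  d : act.X ⟶ act.B
  equivariant : act.ρ ≫ d.hom = P.relMap (𝟙 act.B.carrier) d.hom ≫ P.selfAction act.B

namespace PXMod

variable {P}

/-- Morphisms of precrossed modules. -/
@[ext]
structure Hom (M M' : P.PXMod) where
  act : M.act ⟶ M'.act
  d_comm : M.d ≫ act.g = act.f ≫ M'.d

instance : Category P.PXMod where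
  Hom := Hom
  id M := { act := 𝟙 _, d_comm := by simp }
  comp u w :=
    { act := u.act ≫ w.act
      d_comm := by
        rw [Act.comp_g, Act.comp_f, ← Category.assoc, u.d_comm, Category.assoc, w.d_comm,
          Category.assoc] }

@[ext]
theorem hom_ext {M M' : P.PXMod} {u w : M ⟶ M'} (h : u.act = w.act) : u = w :=
  Hom.ext h

end PXMod

/-- The functor forgetting the equivariant morphism of a precrossed module. -/
def PXMod.forgetMap {P : SymOperad C} : P.PXMod ⥤ P.Act where
  obj M := M.act
  map u := u.act

/-! ### Reflexive graphs -/

/-- A reflexive graph of algebras. -/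
structure ReflGraph where
  E : P.Alg
  B : P.Alg
  s : E ⟶ B
  t : E ⟶ B
  i : B ⟶ E
  i_s : i ≫ s = 𝟙 B
  i_t : i ≫ t = 𝟙 B

namespace ReflGraph

variable {P}

/-- Morphisms of reflexive graphs. -/
@[ext]
structure Hom (G G' : P.ReflGraph) where
  fE : G.E ⟶ G'.E
  fB : G.B ⟶ G'.B
  s_comm : G.s ≫ fB = fE ≫ G'.s
  t_comm : G.t ≫ fB = fE ≫ G'.t
  i_comm : G.i ≫ fE = fB ≫ G'.i

instance : Category P.ReflGraph where
  Hom := Hom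
  id G := { fE := 𝟙 _, fB := 𝟙 _, s_comm := by simp, t_comm := by simp, i_comm := by simp }
  comp u w :=
    { fE := u.fE ≫ w.fE
      fB := u.fB ≫ w.fB
      s_comm := by rw [← Category.assoc, u.s_comm, Category.assoc, w.s_comm, Category.assoc]
      t_comm := by rw [← Category.assoc, u.t_comm, Category.assoc, w.t_comm, Category.assoc]
      i_comm := by rw [← Category.assoc, u.i_comm, Category.assoc, w.i_comm, Category.assoc] }

@[ext]
theorem hom_ext {G G' : P.ReflGraph} {u w : G ⟶ G'} (hE : u.fE = w.fE) (hB : u.fB = w.fB) :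
    u = w :=
  Hom.ext hE hB

end ReflGraph

/-! ### Reflexive graphs and split short exact sequences -/

variable {P}

theorem schur_map_zero [P.IsReduced] (X Y : C) : P.schur.map (0 : X ⟶ Y) = 0 := by
  refine P.schur_hom_ext fun n => ?_
  cases n with
  | zero =>
    have h : IsZero (P.obj (Fin 0) ⊗ tpow X 0) :=
      (tensorRight (tpow X 0)).map_isZero IsReduced.isZero_zero
    exact h.eq_of_src _ _
  | succ n =>
    have h : tpowMap (0 : X ⟶ Y) (n + 1) = 0 := by
      change (0 : X ⟶ Y) ⊗ₘ tpowMap 0 n = 0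
      exact MonoidalPreadditive.zero_tensor _
    rw [toSchur_map, h]
    simp

/-- The structure morphism of the kernel of a morphism of algebras, induced by the one of its
source. -/
noncomputable def kernelStr [P.IsReduced] {E B : P.Alg} (f : E ⟶ B) :
    P.schur.obj (kernel f.hom) ⟶ kernel f.hom :=
  kernel.lift f.hom (P.schur.map (kernel.ι f.hom) ≫ E.str) (by
    rw [Category.assoc, f.str_hom, ← Functor.map_comp_assoc, kernel.condition, schur_map_zero,
      zero_comp])

theorem kernelStr_ι [P.IsReduced] {E B : P.Alg} (f : E ⟶ B) :
    kernelStr f ≫ kernel.ι f.hom = P.schur.map (kernel.ι f.hom) ≫ E.str :=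
  kernel.lift_ι _ _ _

/-- The kernel of a morphism of algebras. -/
noncomputable def kernelAlg [P.IsReduced] {E B : P.Alg} (f : E ⟶ B) : P.Alg where
  carrier := kernel f.hom
  str := kernelStr f
  unit_str := by
    rw [← cancel_mono (kernel.ι f.hom), Category.assoc, kernelStr_ι, reassoc_of% (schurUnit_natural P),
      E.unit_str]
    simp
  assoc_str k := by
    rw [← cancel_mono (kernel.ι f.hom), Category.assoc, Category.assoc, Category.assoc,
      kernelStr_ι, ← Functor.map_comp_assoc, kernelStr_ι, Functor.map_comp_assoc,
      reassoc_of% (nested_natural P), E.assoc_str, reassoc_of% (nestedMul_natural P)]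

/-- The inclusion of the kernel of a morphism of algebras. -/
noncomputable def kernelι [P.IsReduced] {E B : P.Alg} (f : E ⟶ B) : kernelAlg f ⟶ E where
  hom := kernel.ι f.hom
  str_hom := kernelStr_ι f

instance [P.IsReduced] {E B : P.Alg} (f : E ⟶ B) : Mono (kernelι f).hom :=
  inferInstanceAs (Mono (kernel.ι f.hom))

theorem kernelι_comp [P.IsReduced] {E B : P.Alg} (f : E ⟶ B) : (kernelι f).hom ≫ f.hom = 0 :=
  kernel.condition _

/-- The morphism induced on kernels by a commutative square. -/
noncomputable def kernelAlgMap [P.IsReduced] {E B E' B' : P.Alg} {f : E ⟶ B} {f' : E' ⟶ B'}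
    (u : E ⟶ E') (w : B ⟶ B') (h : f ≫ w = u ≫ f') : kernelAlg f ⟶ kernelAlg f' where
  hom := kernel.map f.hom f'.hom u.hom w.hom (congrArg Alg.Hom.hom h)
  str_hom := by
    have e : kernel.map f.hom f'.hom u.hom w.hom (congrArg Alg.Hom.hom h) ≫ kernel.ι f'.hom =
      kernel.ι f.hom ≫ u.hom := kernel.lift_ι _ _ _
    change kernelStr f ≫ kernel.map f.hom f'.hom u.hom w.hom _ =
      P.schur.map (kernel.map f.hom f'.hom u.hom w.hom _) ≫ kernelStr f'
    rw [← cancel_mono (kernel.ι f'.hom), Category.assoc, e, reassoc_of% kernelStr_ι, Category.assoc,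
      kernelStr_ι, ← Functor.map_comp_assoc, e, Functor.map_comp_assoc, u.str_hom]

theorem kernelAlgMap_ι [P.IsReduced] {E B E' B' : P.Alg} {f : E ⟶ B} {f' : E' ⟶ B'}
    (u : E ⟶ E') (w : B ⟶ B') (h : f ≫ w = u ≫ f') :
    kernelAlgMap u w h ≫ kernelι f' = kernelι f ≫ u :=
  Alg.hom_ext (kernel.lift_ι _ _ _)

theorem kernelAlg_hom_ext [P.IsReduced] {Z E B : P.Alg} {f : E ⟶ B} {u w : Z ⟶ kernelAlg f}
    (h : u ≫ kernelι f = w ≫ kernelι f) : u = w := by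
  ext
  exact (cancel_mono (kernelι f).hom).1 (congrArg Alg.Hom.hom h)

/-- The functor forgetting the target `t` of a reflexive graph: the split short exact sequence
`0 ⟶ ker s ⟶ E ⟶ B ⟶ 0`, with projection `s` and section `i`. -/
noncomputable def ReflGraph.forgetTarget [P.IsReduced] : P.ReflGraph ⥤ P.SplitExt where
  obj G :=
    { X := kernelAlg G.s
      E := G.E
      B := G.B
      i := kernelι G.s
      p := G.s
      s := G.i
      s_p := G.i_s
      zero := kernelι_comp G.s
      exact :=
        { exact := ShortComplex.exact_of_f_is_kernel _ (kernelIsKernel G.s.hom)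
          mono_f := inferInstanceAs (Mono (kernelι G.s).hom)
          epi_g := by
            have h : G.i.hom ≫ G.s.hom = 𝟙 _ := congrArg Alg.Hom.hom G.i_s
            exact epi_of_epi_fac h } }
  map u :=
    { fX := kernelAlgMap u.fE u.fB u.s_comm
      fE := u.fE
      fB := u.fB
      i_comm := (kernelAlgMap_ι _ _ _).symm
      p_comm := u.s_comm
      s_comm := u.i_comm }
  map_id G := by
    refine SplitExt.hom_ext (kernelAlg_hom_ext ?_) rfl rfl
    refine (kernelAlgMap_ι (𝟙 G.E) (𝟙 G.B) (𝟙 G : G ⟶ G).s_comm).trans ?_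
    exact (Category.comp_id _).trans (Category.id_comp _).symm
  map_comp {G G' G''} u w := by
    refine SplitExt.hom_ext (kernelAlg_hom_ext ?_) rfl rfl
    change kernelAlgMap (u.fE ≫ w.fE) (u.fB ≫ w.fB)
        (u ≫ w : G ⟶ G'').s_comm ≫ kernelι G''.s =
      (kernelAlgMap u.fE u.fB u.s_comm ≫ kernelAlgMap w.fE w.fB w.s_comm) ≫ kernelι G''.s
    rw [kernelAlgMap_ι, Category.assoc, kernelAlgMap_ι, reassoc_of% kernelAlgMap_ι]

/-! ### Semidirect products -/

/-- The morphism `P(X ⊕ B) ≅ P ∘ (B | X) ⊕ P(B) ⟶ X ⊕ B` with matrix `diag(ρ, μ_B)`. -/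
noncomputable def Act.semidirectStr (a : P.Act) :
    P.schur.obj (a.X.carrier ⊞ a.B.carrier) ⟶ a.X.carrier ⊞ a.B.carrier :=
  biprod.lift (P.relProj a.B.carrier a.X.carrier) (P.schur.map biprod.snd) ≫
    biprod.map a.ρ a.B.str

@[simp]
theorem Act.semidirectStr_fst (a : P.Act) :
    a.semidirectStr ≫ biprod.fst = P.relProj a.B.carrier a.X.carrier ≫ a.ρ := by
  simp [Act.semidirectStr]

@[simp]
theorem Act.semidirectStr_snd (a : P.Act) :
    a.semidirectStr ≫ biprod.snd = P.schur.map biprod.snd ≫ a.B.str := by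
  simp [Act.semidirectStr]

theorem Act.inl_semidirectStr [P.IsReduced] (a : P.Act) :
    P.schur.map biprod.inl ≫ a.semidirectStr = a.X.str ≫ biprod.inl := by
  refine biprod.hom_ext _ _ ?_ ?_
  · rw [Category.assoc, Category.assoc, biprod.inl_fst, Act.semidirectStr_fst,
      ← Category.assoc (P.schur.map _), a.isAction.compat, Category.comp_id]
  · rw [Category.assoc, Category.assoc, biprod.inl_snd, Act.semidirectStr_snd,
      ← Functor.map_comp_assoc, biprod.inl_snd, schur_map_zero]
    simp

theorem Act.inr_semidirectStr (a : P.Act) :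
    P.schur.map biprod.inr ≫ a.semidirectStr = a.B.str ≫ biprod.inr := by
  refine biprod.hom_ext _ _ ?_ ?_
  · rw [Category.assoc, Category.assoc, biprod.inr_fst, Act.semidirectStr_fst,
      reassoc_of% (schur_inr_relProj P)]
    simp
  · rw [Category.assoc, Category.assoc, biprod.inr_snd, Act.semidirectStr_snd,
      ← Functor.map_comp_assoc, biprod.inr_snd]
    simp

/-- The semidirect product algebra `X ⊕ B` of an internal action. -/
noncomputable def Act.semidirectAlg [P.IsReduced] (a : P.Act) : P.Alg where
  carrier := a.X.carrier ⊞ a.B.carrier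
  str := a.semidirectStr
  unit_str := by
    refine biprod.hom_ext' _ _ ?_ ?_
    · rw [← reassoc_of% (schurUnit_natural P), Act.inl_semidirectStr, ← Category.assoc, a.X.unit_str]
      simp
    · rw [← reassoc_of% (schurUnit_natural P), Act.inr_semidirectStr, ← Category.assoc, a.B.unit_str]
      simp
  assoc_str k := by
    refine biprod.hom_ext _ _ ?_ ?_
    · simp only [Category.assoc, Act.semidirectStr_fst]
      rw [← a.isAction.assoc k, Act.semidirectStr, Functor.map_comp_assoc, reassoc_of% (relProj_map P)]
    · simp only [Category.assoc, Act.semidirectStr_snd]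
      rw [← Functor.map_comp_assoc, Act.semidirectStr_snd, Functor.map_comp_assoc,
        reassoc_of% (nested_natural P), a.B.assoc_str, reassoc_of% (nestedMul_natural P)]

/-- The functor sending an internal action of `B` on `X` to the split short exact sequence
`0 ⟶ X ⟶ X ⊕ B ⟶ B ⟶ 0`. -/
noncomputable def Act.semidirect [P.IsReduced] : P.Act ⥤ P.SplitExt where
  obj a :=
    { X := a.X
      E := a.semidirectAlg
      B := a.B
      i :=
        { hom := (biprod.inl : a.X.carrier ⟶ a.X.carrier ⊞ a.B.carrier)
          str_hom := a.inl_semidirectStr.symm }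
      p :=
        { hom := (biprod.snd : a.X.carrier ⊞ a.B.carrier ⟶ a.B.carrier)
          str_hom := a.semidirectStr_snd }
      s :=
        { hom := (biprod.inr : a.B.carrier ⟶ a.X.carrier ⊞ a.B.carrier)
          str_hom := a.inr_semidirectStr.symm }
      s_p := by
        ext
        exact biprod.inr_snd
      zero := biprod.inl_snd
      exact := (ShortComplex.Splitting.ofHasBinaryBiproduct a.X.carrier a.B.carrier).shortExact }
  map {a a'} u :=
    { fX := u.f
      fE :=
        { hom := biprod.map u.f.hom u.g.hom
          str_hom := by
            change a.semidirectStr ≫ _ = P.schur.map _ ≫ a'.semidirectStr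
            refine biprod.hom_ext _ _ ?_ ?_
            · simp only [Category.assoc, biprod.map_fst, Act.semidirectStr_fst,
                reassoc_of% Act.semidirectStr_fst, u.ρ_comm, reassoc_of% (relProj_map P)]
            · simp only [Category.assoc, biprod.map_snd, Act.semidirectStr_snd,
                reassoc_of% Act.semidirectStr_snd, u.g.str_hom]
              rw [← Functor.map_comp_assoc, ← Functor.map_comp_assoc, biprod.map_snd] }
      fB := u.g
      i_comm := by
        ext
        exact biprod.inl_map _ _
      p_comm := by
        ext
        exact (biprod.map_snd _ _).symm
      s_comm := by
        ext
        exact biprod.inr_map _ _ }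
  map_id a := by
    ext
    · rfl
    · change biprod.map (𝟙 a.X.carrier) (𝟙 a.B.carrier) = 𝟙 _
      ext <;> simp
    · rfl
  map_comp {a b c} u w := by
    ext
    · rfl
    · change biprod.map (u.f.hom ≫ w.f.hom) (u.g.hom ≫ w.g.hom) =
        biprod.map u.f.hom u.g.hom ≫ biprod.map w.f.hom w.g.hom
      ext <;> simp
    · rfl

/-! ### The internal action of a split short exact sequence -/

/-- The morphism `P ∘ (B | X) ⟶ P(X ⊕ B) ⟶ P(E) ⟶ E` of a split short exact sequence. -/
noncomputable def SplitExt.preAction (S : P.SplitExt) :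
    P.rel S.B.carrier S.X.carrier ⟶ S.E.carrier :=
  P.relIncl _ _ ≫ P.schur.map (biprod.desc S.i.hom S.s.hom) ≫ S.E.str

theorem biprod_lift_map {W X Y X' Y' : C} (f : W ⟶ X) (g : W ⟶ Y) (p : X ⟶ X') (q : Y ⟶ Y') :
    biprod.lift f g ≫ biprod.map p q = biprod.lift (f ≫ p) (g ≫ q) := by
  ext <;> simp

theorem SplitExt.desc_p (S : P.SplitExt) :
    biprod.desc S.i.hom S.s.hom ≫ S.p.hom = biprod.snd := by
  have h : S.s.hom ≫ S.p.hom = 𝟙 _ := congrArg Alg.Hom.hom S.s_p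
  refine biprod.hom_ext' _ _ ?_ ?_
  · rw [biprod.inl_desc_assoc, S.zero, biprod.inl_snd]
  · rw [biprod.inr_desc_assoc, h, biprod.inr_snd]

theorem SplitExt.preAction_p (S : P.SplitExt) : S.preAction ≫ S.p.hom = 0 := by
  rw [SplitExt.preAction, Category.assoc, Category.assoc, S.p.str_hom, ← Functor.map_comp_assoc,
    S.desc_p, reassoc_of% (relIncl_schur_snd P), zero_comp]

theorem SplitExt.mono_i (S : P.SplitExt) : Mono S.i.hom := S.exact.mono_f

/-- The action of `B` on `X` defined by a split short exact sequence `0 ⟶ X ⟶ E ⟶ B ⟶ 0`: the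
corestriction to `X` of `P ∘ (B | X) ⟶ P(X ⊕ B) ⟶ P(E) ⟶ E`. -/
noncomputable def SplitExt.action (S : P.SplitExt) :
    P.rel S.B.carrier S.X.carrier ⟶ S.X.carrier :=
  S.exact.fIsKernel.lift (KernelFork.ofι S.preAction S.preAction_p)

theorem SplitExt.action_i (S : P.SplitExt) : S.action ≫ S.i.hom = S.preAction :=
  S.exact.fIsKernel.fac _ WalkingParallelPair.zero

theorem SplitExt.relProj_action_i (S : P.SplitExt) :
    P.relProj _ _ ≫ S.action ≫ S.i.hom =
      P.schur.map (biprod.desc S.i.hom S.s.hom) ≫ S.E.str -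
        P.schur.map biprod.snd ≫ S.B.str ≫ S.s.hom := by
  rw [S.action_i, SplitExt.preAction, reassoc_of% (relProj_relIncl P), Preadditive.sub_comp,
    Category.id_comp, ← Functor.map_comp_assoc, Category.assoc, biprod.inr_desc,
    Functor.map_comp_assoc, S.s.str_hom]

theorem SplitExt.matrix_desc (S : P.SplitExt) :
    (biprod.lift (P.relProj _ _) (P.schur.map biprod.snd) ≫ biprod.map S.action S.B.str) ≫
      biprod.desc S.i.hom S.s.hom = P.schur.map (biprod.desc S.i.hom S.s.hom) ≫ S.E.str := by
  rw [biprod_lift_map, biprod.lift_desc, Category.assoc, Category.assoc, S.relProj_action_i]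
  simp

theorem SplitExt.isAction [P.IsReduced] (S : P.SplitExt) : P.IsAction S.B S.X S.action where
  compat := by
    have := S.mono_i
    rw [← cancel_mono S.i.hom, Category.assoc, Category.assoc, S.relProj_action_i,
      Preadditive.comp_sub, ← Functor.map_comp_assoc, ← Functor.map_comp_assoc, biprod.inl_desc,
      biprod.inl_snd, schur_map_zero, zero_comp, sub_zero, S.i.str_hom]
  assoc k := by
    have := S.mono_i
    rw [reassoc_of% (relProj_map P), ← Functor.map_comp_assoc, ← cancel_mono S.i.hom]
    simp only [Category.assoc]
    rw [S.relProj_action_i, Preadditive.comp_sub, ← Functor.map_comp_assoc, S.matrix_desc,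
      ← Functor.map_comp_assoc, biprod_lift_map, biprod.lift_snd, Functor.map_comp_assoc,
      Functor.map_comp_assoc, Preadditive.comp_sub, Preadditive.comp_sub, reassoc_of% (nested_natural P),
      reassoc_of% (nested_natural P), S.E.assoc_str, reassoc_of% (nestedMul_natural P),
      reassoc_of% (S.B.assoc_str k), reassoc_of% (nestedMul_natural P)]

/-- The functor sending a split short exact sequence `0 ⟶ X ⟶ E ⟶ B ⟶ 0` to the internal action
of `B` on `X` which it defines. -/
noncomputable def SplitExt.toAct [P.IsReduced] : P.SplitExt ⥤ P.Act where
  obj S :=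
    { B := S.B
      X := S.X
      ρ := S.action
      isAction := S.isAction }
  map {S S'} u :=
    { g := u.fB
      f := u.fX
      ρ_comm := by
        have := S'.mono_i
        have h1 : S.i.hom ≫ u.fE.hom = u.fX.hom ≫ S'.i.hom := congrArg Alg.Hom.hom u.i_comm
        have h2 : S.s.hom ≫ u.fE.hom = u.fB.hom ≫ S'.s.hom := congrArg Alg.Hom.hom u.s_comm
        have h3 : biprod.desc S.i.hom S.s.hom ≫ u.fE.hom =
            biprod.map u.fX.hom u.fB.hom ≫ biprod.desc S'.i.hom S'.s.hom := by
          refine biprod.hom_ext' _ _ ?_ ?_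
          · rw [biprod.inl_desc_assoc, biprod.inl_map_assoc, biprod.inl_desc, h1]
          · rw [biprod.inr_desc_assoc, biprod.inr_map_assoc, biprod.inr_desc, h2]
        rw [← cancel_mono S'.i.hom, ← cancel_epi (P.relProj _ _), Category.assoc, ← h1,
          Category.assoc, reassoc_of% (relProj_map P), S'.relProj_action_i, reassoc_of% S.relProj_action_i,
          Preadditive.comp_sub, Preadditive.sub_comp, ← Functor.map_comp_assoc, ← h3,
          Functor.map_comp_assoc, Category.assoc, u.fE.str_hom,
          ← P.schur.map_comp_assoc (biprod.map u.fX.hom u.fB.hom), biprod.map_snd, Category.assoc, Category.assoc, h2, Functor.map_comp_assoc,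
          reassoc_of% u.fB.str_hom] }

/-! ### Precrossed modules and reflexive graphs -/

theorem relProj_selfAction (B : P.Alg) :
    P.relProj B.carrier B.carrier ≫ P.selfAction B =
      P.schur.map (biprod.desc (𝟙 _) (𝟙 _)) ≫ B.str - P.schur.map biprod.snd ≫ B.str := by
  rw [selfAction, reassoc_of% (relProj_relIncl P), Preadditive.sub_comp, Category.id_comp,
    ← Functor.map_comp_assoc, Category.assoc, biprod.inr_desc, Category.comp_id]

theorem relProj_relMap_selfAction {X B : P.Alg} (d : X ⟶ B) :
    P.relProj B.carrier X.carrier ≫ P.relMap (𝟙 B.carrier) d.hom ≫ P.selfAction B =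
      P.schur.map (biprod.desc d.hom (𝟙 _)) ≫ B.str - P.schur.map biprod.snd ≫ B.str := by
  have h : biprod.map d.hom (𝟙 B.carrier) ≫ biprod.desc (𝟙 _) (𝟙 _) = biprod.desc d.hom (𝟙 _) := by
    ext <;> simp
  rw [reassoc_of% (relProj_map P), relProj_selfAction, Preadditive.comp_sub, ← Functor.map_comp_assoc,
    ← Functor.map_comp_assoc, h, biprod.map_snd, Category.comp_id]

/-- The morphism of algebras `d ⊕ 1 : X ⊕ B ⟶ B` of a precrossed module. -/
noncomputable def PXMod.target [P.IsReduced] (M : P.PXMod) : M.act.semidirectAlg ⟶ M.act.B where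
  hom := (biprod.desc M.d.hom (𝟙 _) : M.act.X.carrier ⊞ M.act.B.carrier ⟶ M.act.B.carrier)
  str_hom := by
    change M.act.semidirectStr ≫ biprod.desc M.d.hom (𝟙 _) = _
    rw [Act.semidirectStr, biprod_lift_map, biprod.lift_desc, Category.assoc, M.equivariant,
      relProj_relMap_selfAction, Category.comp_id]
    exact sub_add_cancel _ _

/-- The functor sending a precrossed module to the reflexive graph `X ⊕ B ⇉ B` with source
`0 ⊕ 1`, target `d ⊕ 1` and unit the inclusion of `B`. -/
noncomputable def PXMod.toReflGraph [P.IsReduced] : P.PXMod ⥤ P.ReflGraph where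
  obj M :=
    { E := M.act.semidirectAlg
      B := M.act.B
      s := (Act.semidirect.obj M.act).p
      t := M.target
      i := (Act.semidirect.obj M.act).s
      i_s := (Act.semidirect.obj M.act).s_p
      i_t := Alg.hom_ext (biprod.inr_desc _ _) }
  map {M M'} u :=
    { fE := (Act.semidirect.map u.act).fE
      fB := u.act.g
      s_comm := (Act.semidirect.map u.act).p_comm
      t_comm := by
        have h : M.d.hom ≫ u.act.g.hom = u.act.f.hom ≫ M'.d.hom := congrArg Alg.Hom.hom u.d_comm
        refine Alg.hom_ext ?_
        change biprod.desc M.d.hom (𝟙 _) ≫ u.act.g.hom =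
          biprod.map u.act.f.hom u.act.g.hom ≫ biprod.desc M'.d.hom (𝟙 _)
        refine biprod.hom_ext' _ _ ?_ ?_
        · rw [biprod.inl_desc_assoc, biprod.inl_map_assoc, biprod.inl_desc, h]
        · simp
      i_comm := (Act.semidirect.map u.act).s_comm }
  map_id M := ReflGraph.hom_ext (congrArg SplitExt.Hom.fE (Act.semidirect.map_id M.act)) rfl
  map_comp u w :=
    ReflGraph.hom_ext (congrArg SplitExt.Hom.fE (Act.semidirect.map_comp u.act w.act)) rfl

theorem SplitExt.equivariant (S : P.SplitExt) (t : S.E ⟶ S.B) (h : S.s ≫ t = 𝟙 S.B) :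
    S.action ≫ (S.i ≫ t).hom =
      P.relMap (𝟙 S.B.carrier) (S.i ≫ t).hom ≫ P.selfAction S.B := by
  have h1 : S.s.hom ≫ t.hom = 𝟙 _ := congrArg Alg.Hom.hom h
  have h2 : biprod.desc S.i.hom S.s.hom ≫ t.hom = biprod.desc (S.i ≫ t).hom (𝟙 _) := by
    refine biprod.hom_ext' _ _ ?_ ?_
    · rw [biprod.inl_desc_assoc, biprod.inl_desc, Alg.comp_hom]
    · rw [biprod.inr_desc_assoc, biprod.inr_desc, h1]
  rw [← cancel_epi (P.relProj _ _), relProj_relMap_selfAction, Alg.comp_hom,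
    reassoc_of% S.relProj_action_i, Preadditive.sub_comp, Category.assoc, t.str_hom,
    ← Functor.map_comp_assoc, h2, Category.assoc, Category.assoc, h1, Category.comp_id,
    Alg.comp_hom]

/-- The functor sending a reflexive graph to the action of `B` on `ker s` with the restriction of
`t` to `ker s`. -/
noncomputable def ReflGraph.toPXMod [P.IsReduced] : P.ReflGraph ⥤ P.PXMod where
  obj G :=
    { act := SplitExt.toAct.obj (ReflGraph.forgetTarget.obj G)
      d := (ReflGraph.forgetTarget.obj G).i ≫ G.t
      equivariant := SplitExt.equivariant (ReflGraph.forgetTarget.obj G) G.t G.i_t }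
  map {G G'} u :=
    { act := SplitExt.toAct.map (ReflGraph.forgetTarget.map u)
      d_comm := by
        change (kernelι G.s ≫ G.t) ≫ u.fB =
          kernelAlgMap u.fE u.fB u.s_comm ≫ kernelι G'.s ≫ G'.t
        rw [reassoc_of% kernelAlgMap_ι, Category.assoc, u.t_comm] }
  map_id G := PXMod.hom_ext
    ((congrArg SplitExt.toAct.map (ReflGraph.forgetTarget.map_id G)).trans
      (SplitExt.toAct.map_id _))
  map_comp u w := PXMod.hom_ext
    ((congrArg SplitExt.toAct.map (ReflGraph.forgetTarget.map_comp u w)).trans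
      (SplitExt.toAct.map_comp _ _))

end Schur

end SymOperad

/-! The whole theorem rests on the splitting P(X ⊕ B) = P ∘ (B | X) ⊕ P(B), whose first projection
`relProj` is split by `relIncl` (induced by 1 - e^{⊗ n}, with e the projector of X ⊕ B onto B). A
structure map on X ⊕ B for which the inclusion of B and the projection to B are algebra morphisms
has no freedom on P(B). Its remaining datum is a morphism P ∘ (B | X) ⟶ X, and associativity of the
structure map becomes the axiom of an action. As P_0 = 0, P sends zero morphisms to zero, so X is a
subalgebra and kernels of algebra morphisms are algebras.

Given a split sequence, (i, s) : X ⊕ B ⟶ E is invertible in the abelian category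
(`SplitExt.isIso_desc`) and carries diag(ρ, μ_B) to μ_E (`SplitExt.matrix_desc`): on P ∘ (B | X) by
the definition of ρ, on P(B) because s is an algebra morphism. Hence every split sequence is a
semidirect product. Starting from an action, the first component of the structure map restricted
along `relIncl` is ρ again (`Act.action_semidirect`). This gives the first equivalence.

For the second, a morphism t : X ⊕ B ⟶ B which is the identity on B is a pair (d, 1). Its
compatibility with the structure maps is automatic on P(B), and on P ∘ (B | X) it is the
equivariance of d; both directions are in `PXMod.target` and `SplitExt.equivariant`. The
isomorphisms of the first equivalence therefore only have to be checked against d and t. One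
correction is needed: the kernel of X ⊕ B ⟶ B is isomorphic to X but not equal to it. The comparison
`SplitExt.toKernel` accounts for this, and yields both the commutation of the square and the unit of
the second equivalence. -/

namespace SymOperad

variable {C : Type u} [Category.{v} C] [Abelian C] [HasColimits C] [MonoidalCategory C]
  [SymmetricCategory C] [MonoidalClosed C] {P : SymOperad C}

/-! ### Isomorphisms in the categories of the theorem -/

/-- The forgetful functor from algebras reflects isomorphisms. -/
theorem Alg.isIso_of_isIso_hom {X Y : P.Alg} (f : X ⟶ Y) [IsIso f.hom] : IsIso f := by
  refine ⟨⟨{ hom := inv f.hom, str_hom := ?_ }, ?_, ?_⟩⟩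
  · rw [← cancel_mono f.hom, Category.assoc, Category.assoc, IsIso.inv_hom_id, Category.comp_id,
      f.str_hom, ← Functor.map_comp_assoc, IsIso.inv_hom_id]
    simp
  · ext
    exact IsIso.hom_inv_id _
  · ext
    exact IsIso.inv_hom_id _

/-- Commuting squares with invertible comparison maps stay commutative when these maps are inverted.
Comparisons of sequences can thus be inverted term by term. -/
theorem SplitExt.isIso_of_isIso {S S' : P.SplitExt} (u : S ⟶ S') [IsIso u.fX] [IsIso u.fE]
    [IsIso u.fB] : IsIso u := by
  refine ⟨⟨⟨inv u.fX, inv u.fE, inv u.fB, ?_, ?_, ?_⟩, ?_, ?_⟩⟩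
  · rw [IsIso.comp_inv_eq, Category.assoc, u.i_comm, IsIso.inv_hom_id_assoc]
  · rw [IsIso.comp_inv_eq, Category.assoc, u.p_comm, IsIso.inv_hom_id_assoc]
  · rw [IsIso.comp_inv_eq, Category.assoc, u.s_comm, IsIso.inv_hom_id_assoc]
  · exact SplitExt.hom_ext (IsIso.hom_inv_id _) (IsIso.hom_inv_id _) (IsIso.hom_inv_id _)
  · exact SplitExt.hom_ext (IsIso.inv_hom_id _) (IsIso.inv_hom_id _) (IsIso.inv_hom_id _)

theorem PXMod.isIso_of_isIso {M M' : P.PXMod} (u : M ⟶ M') [IsIso u.act] : IsIso u := by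
  have hg : u.act.g ≫ (inv u.act).g = 𝟙 _ := by
    rw [← Act.comp_g, IsIso.hom_inv_id, Act.id_g]
  have hf : (inv u.act).f ≫ u.act.f = 𝟙 _ := by
    rw [← Act.comp_f, IsIso.inv_hom_id, Act.id_f]
  refine ⟨⟨{ act := inv u.act, d_comm := ?_ }, ?_, ?_⟩⟩
  -- Conjugation of the square: d' g⁻¹ is rewritten, in diagrammatic order, as f⁻¹ f d' g⁻¹ = f⁻¹ d
  -- g g⁻¹ = f⁻¹ d.
  · rw [← Category.id_comp M'.d, ← hf, Category.assoc, Category.assoc, ← reassoc_of% u.d_comm, hg,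
      Category.comp_id]
  · exact PXMod.hom_ext (IsIso.hom_inv_id _)
  · exact PXMod.hom_ext (IsIso.inv_hom_id _)

theorem ReflGraph.isIso_of_isIso {G G' : P.ReflGraph} (u : G ⟶ G') [IsIso u.fE] [IsIso u.fB] :
    IsIso u := by
  refine ⟨⟨{ fE := inv u.fE, fB := inv u.fB, s_comm := ?_, t_comm := ?_, i_comm := ?_ }, ?_, ?_⟩⟩
  · rw [IsIso.comp_inv_eq, Category.assoc, u.s_comm, IsIso.inv_hom_id_assoc]
  · rw [IsIso.comp_inv_eq, Category.assoc, u.t_comm, IsIso.inv_hom_id_assoc]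
  · rw [IsIso.comp_inv_eq, Category.assoc, u.i_comm, IsIso.inv_hom_id_assoc]
  · exact ReflGraph.hom_ext (IsIso.hom_inv_id _) (IsIso.hom_inv_id _)
  · exact ReflGraph.hom_ext (IsIso.inv_hom_id _) (IsIso.inv_hom_id _)

/-! ### Actions and split short exact sequences -/

/-- In a split short exact sequence, `(i, s) : X ⊕ B ⟶ E` is an isomorphism. -/
theorem SplitExt.isIso_desc (S : P.SplitExt) : IsIso (biprod.desc S.i.hom S.s.hom) := by
  have hs : S.s.hom ≫ S.p.hom = 𝟙 _ := congrArg Alg.Hom.hom S.s_p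
  -- The retraction `σ.r` of i lives in the underlying abelian category and need not be an algebra
  -- morphism. Together with p it gives the inverse of (i, s).
  let σ := ShortComplex.Splitting.ofExactOfSection _ S.exact.exact S.s.hom hs S.exact.mono_f
  have h1 : S.i.hom ≫ σ.r = 𝟙 _ := σ.f_r
  have h2 : σ.r ≫ S.i.hom + S.p.hom ≫ S.s.hom = 𝟙 _ := σ.id
  have h3 : S.s.hom ≫ σ.r = 0 := σ.s_r
  refine ⟨⟨biprod.lift σ.r S.p.hom, ?_, ?_⟩⟩
  · refine biprod.hom_ext' _ _ ?_ ?_ <;> refine biprod.hom_ext _ _ ?_ ?_ <;>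
      simp [h1, h3, hs, S.zero]
  · rw [biprod.lift_desc, h2]

variable [P.IsReduced]

/-- The action defined by the semidirect product sequence of an action is that action. -/
theorem Act.action_semidirect (a : P.Act) : (Act.semidirect.obj a).action = a.ρ := by
  have h := (Act.semidirect.obj a).action_i
  change (Act.semidirect.obj a).action ≫ (biprod.inl : a.X.carrier ⟶ a.X.carrier ⊞ a.B.carrier) =
    P.relIncl a.B.carrier a.X.carrier ≫ P.schur.map (biprod.desc biprod.inl biprod.inr) ≫
      a.semidirectStr at h
  refine (Category.comp_id _).symm.trans ?_
  -- Here i is the inclusion of X, which has the retraction `biprod.fst`; composing with it turns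
  -- the defining factorization `h` into a formula for the action.
  refine (congrArg (fun z => (Act.semidirect.obj a).action ≫ z)
    (biprod.inl_fst (X := a.X.carrier) (Y := a.B.carrier)).symm).trans ?_
  refine (Category.assoc _ _ _).symm.trans ((congrArg (fun z => z ≫ biprod.fst) h).trans ?_)
  change (P.relIncl a.B.carrier a.X.carrier ≫ P.schur.map (biprod.desc biprod.inl biprod.inr) ≫
    a.semidirectStr) ≫ (biprod.fst : a.X.carrier ⊞ a.B.carrier ⟶ a.X.carrier) = a.ρ
  have hd : biprod.desc biprod.inl biprod.inr = 𝟙 (a.X.carrier ⊞ a.B.carrier) := by ext <;> simp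
  -- The first component of the structure map is `relProj` followed by ρ, and `relIncl` is a section
  -- of `relProj`, so only ρ remains.
  rw [hd, CategoryTheory.Functor.map_id, Category.id_comp, Category.assoc, Act.semidirectStr_fst,
    ← Category.assoc, relIncl_relProj, Category.id_comp]

/-- An action is naturally isomorphic to the action defined by its semidirect product sequence. -/
noncomputable def Act.unitIso : 𝟭 P.Act ≅ Act.semidirect ⋙ SplitExt.toAct :=
  -- The round trip keeps B and X as they are and changes ρ only by the equality
  -- `Act.action_semidirect`, so identities serve as components in both directions.
  have hρ (a : P.Act) : a.ρ ≫ (𝟙 a.X : a.X ⟶ a.X).hom =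
      P.relMap (𝟙 a.B : a.B ⟶ a.B).hom (𝟙 a.X : a.X ⟶ a.X).hom ≫
        (Act.semidirect.obj a).action := by
    rw [a.action_semidirect, Alg.id_hom, Alg.id_hom, relMap_id]
    exact (Category.comp_id _).trans (Category.id_comp _).symm
  have hρ' (a : P.Act) : (Act.semidirect.obj a).action ≫ (𝟙 a.X : a.X ⟶ a.X).hom =
      P.relMap (𝟙 a.B : a.B ⟶ a.B).hom (𝟙 a.X : a.X ⟶ a.X).hom ≫ a.ρ := by
    rw [a.action_semidirect, Alg.id_hom, Alg.id_hom, relMap_id]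
    exact (Category.comp_id _).trans (Category.id_comp _).symm
  NatIso.ofComponents
    (fun a =>
      { hom := { g := 𝟙 a.B, f := 𝟙 a.X, ρ_comm := hρ a }
        inv := { g := 𝟙 a.B, f := 𝟙 a.X, ρ_comm := hρ' a }
        hom_inv_id := Act.hom_ext (Category.id_comp _) (Category.id_comp _)
        inv_hom_id := Act.hom_ext (Category.id_comp _) (Category.id_comp _) })
    (fun u => Act.hom_ext ((Category.comp_id u.g).trans (Category.id_comp u.g).symm)
      ((Category.comp_id u.f).trans (Category.id_comp u.f).symm))

/-! ### Every split short exact sequence is a semidirect product -/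

/-- The isomorphism of algebras `(i, s) : X ⊕ B ⟶ E` of a split short exact sequence. -/
noncomputable def SplitExt.descHom (S : P.SplitExt) :
    (SplitExt.toAct.obj S).semidirectAlg ⟶ S.E where
  hom := biprod.desc S.i.hom S.s.hom
  str_hom := S.matrix_desc

instance (S : P.SplitExt) : IsIso S.descHom :=
  have : IsIso S.descHom.hom := S.isIso_desc
  Alg.isIso_of_isIso_hom _

/-- Morphisms out of X ⊕ B are tested on the two summands, where the claim is the compatibility of
`u` with i and with s. This gives the naturality of the counits of both equivalences. -/
theorem SplitExt.descHom_natural {S S' : P.SplitExt} (u : S ⟶ S') :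
    (Act.semidirect.map (SplitExt.toAct.map u)).fE ≫ S'.descHom = S.descHom ≫ u.fE := by
  have h1 : S.i.hom ≫ u.fE.hom = u.fX.hom ≫ S'.i.hom := congrArg Alg.Hom.hom u.i_comm
  have h2 : S.s.hom ≫ u.fE.hom = u.fB.hom ≫ S'.s.hom := congrArg Alg.Hom.hom u.s_comm
  refine Alg.hom_ext ?_
  change biprod.map u.fX.hom u.fB.hom ≫ biprod.desc S'.i.hom S'.s.hom =
    biprod.desc S.i.hom S.s.hom ≫ u.fE.hom
  refine biprod.hom_ext' _ _ ?_ ?_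
  · rw [biprod.inl_desc_assoc, biprod.inl_map_assoc, biprod.inl_desc, h1]
  · rw [biprod.inr_desc_assoc, biprod.inr_map_assoc, biprod.inr_desc, h2]

/-- The comparison of the semidirect product sequence with a split short exact sequence. -/
noncomputable def SplitExt.counitHom (S : P.SplitExt) :
    Act.semidirect.obj (SplitExt.toAct.obj S) ⟶ S where
  fX := 𝟙 S.X
  fE := S.descHom
  fB := 𝟙 S.B
  i_comm := Alg.hom_ext ((biprod.inl_desc _ _).trans (Category.id_comp _).symm)
  p_comm := Alg.hom_ext ((Category.comp_id _).trans S.desc_p.symm)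
  s_comm := Alg.hom_ext ((biprod.inr_desc _ _).trans (Category.id_comp _).symm)

instance (S : P.SplitExt) : IsIso S.counitHom :=
  have : IsIso S.counitHom.fX := inferInstanceAs (IsIso (𝟙 S.X))
  have : IsIso S.counitHom.fE := inferInstanceAs (IsIso S.descHom)
  have : IsIso S.counitHom.fB := inferInstanceAs (IsIso (𝟙 S.B))
  SplitExt.isIso_of_isIso _

/-- A split short exact sequence is naturally isomorphic to the semidirect product sequence of the
action which it defines. -/
noncomputable def SplitExt.counitIso : SplitExt.toAct ⋙ Act.semidirect ≅ 𝟭 P.SplitExt :=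
  NatIso.ofComponents (fun S => asIso (X := Act.semidirect.obj (SplitExt.toAct.obj S)) (Y := S) S.counitHom)
    (fun u =>
    SplitExt.hom_ext ((Category.comp_id u.fX).trans (Category.id_comp u.fX).symm)
      (SplitExt.descHom_natural u) ((Category.comp_id u.fB).trans (Category.id_comp u.fB).symm))

variable (P) in
/-- Internal actions are equivalent to split short exact sequences. -/
noncomputable def actEquivSplitExt : P.Act ≌ P.SplitExt :=
  -- No triangle identity is required: `Equivalence.mk` corrects the unit and keeps the two functors
  -- unchanged.
  CategoryTheory.Equivalence.mk Act.semidirect SplitExt.toAct Act.unitIso SplitExt.counitIso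

/-! ### Precrossed modules and reflexive graphs -/

/-- The comparison of the first term of a split short exact sequence with the kernel of its
projection. -/
noncomputable def SplitExt.toKernel (S : P.SplitExt) : S.X ⟶ kernelAlg S.p where
  hom := kernel.lift S.p.hom S.i.hom S.zero
  str_hom := by
    change S.X.str ≫ kernel.lift S.p.hom S.i.hom S.zero =
      P.schur.map (kernel.lift S.p.hom S.i.hom S.zero) ≫ kernelStr S.p
    rw [← cancel_mono (kernel.ι S.p.hom), Category.assoc, Category.assoc, kernelStr_ι,
      kernel.lift_ι, ← Functor.map_comp_assoc, kernel.lift_ι, S.i.str_hom]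

@[simp]
theorem SplitExt.toKernel_ι (S : P.SplitExt) : S.toKernel ≫ kernelι S.p = S.i :=
  Alg.hom_ext (kernel.lift_ι _ _ _)

/-- By exactness X is itself a kernel of p, so uniqueness of kernels gives an inverse `r` on
underlying objects, which is then automatically an algebra morphism. -/
instance (S : P.SplitExt) : IsIso S.toKernel := by
  have hι : S.toKernel.hom ≫ (kernelι S.p).hom = S.i.hom := congrArg Alg.Hom.hom S.toKernel_ι
  let r : (kernelAlg S.p).carrier ⟶ S.X.carrier :=
    S.exact.fIsKernel.lift (KernelFork.ofι (kernelι S.p).hom (kernelι_comp S.p))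
  have hr : r ≫ S.i.hom = (kernelι S.p).hom := S.exact.fIsKernel.fac _ WalkingParallelPair.zero
  have := S.mono_i
  have : IsIso S.toKernel.hom := by
    refine ⟨⟨r, ?_, ?_⟩⟩
    · rw [← cancel_mono S.i.hom, Category.assoc, hr, hι, Category.id_comp]
    · rw [← cancel_mono (kernelι S.p).hom, Category.assoc, hι, hr, Category.id_comp]
  exact Alg.isIso_of_isIso_hom _

/-- After the inclusion of the kernel into E', both sides become i followed by `u.fE`. -/
theorem SplitExt.toKernel_natural {S S' : P.SplitExt} (u : S ⟶ S') :
    u.fX ≫ S'.toKernel = S.toKernel ≫ kernelAlgMap u.fE u.fB u.p_comm := by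
  refine kernelAlg_hom_ext ?_
  rw [Category.assoc, Category.assoc, kernelAlgMap_ι, S'.toKernel_ι, ← u.i_comm,
    ← Category.assoc S.toKernel, S.toKernel_ι]

/-! ### The square over actions and split sequences -/

/-- The comparison of the semidirect product sequence of a precrossed module with the sequence
`0 ⟶ ker s ⟶ X ⊕ B ⟶ B ⟶ 0` of its reflexive graph. -/
noncomputable def PXMod.forgetTargetInv (M : P.PXMod) :
    Act.semidirect.obj M.act ⟶ ReflGraph.forgetTarget.obj (PXMod.toReflGraph.obj M) where
  fX := (Act.semidirect.obj M.act).toKernel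
  fE := 𝟙 M.act.semidirectAlg
  fB := 𝟙 M.act.B
  i_comm := (Category.comp_id _).trans (Act.semidirect.obj M.act).toKernel_ι.symm
  p_comm := (Category.comp_id _).trans (Category.id_comp _).symm
  s_comm := (Category.comp_id _).trans (Category.id_comp _).symm

instance (M : P.PXMod) : IsIso M.forgetTargetInv :=
  have : IsIso M.forgetTargetInv.fX :=
    inferInstanceAs (IsIso (Act.semidirect.obj M.act).toKernel)
  have : IsIso M.forgetTargetInv.fE := inferInstanceAs (IsIso (𝟙 M.act.semidirectAlg))
  have : IsIso M.forgetTargetInv.fB := inferInstanceAs (IsIso (𝟙 M.act.B))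
  SplitExt.isIso_of_isIso _

/-- Only the kernel term has content, and there it is `SplitExt.toKernel_natural`; the other two
components of the comparison are identities. -/
theorem PXMod.forgetTargetInv_natural {M M' : P.PXMod} (u : M ⟶ M') :
    Act.semidirect.map u.act ≫ M'.forgetTargetInv =
      M.forgetTargetInv ≫ ReflGraph.forgetTarget.map (PXMod.toReflGraph.map u) := by
  exact SplitExt.hom_ext (SplitExt.toKernel_natural (Act.semidirect.map u.act))
    ((Category.comp_id _).trans (Category.id_comp _).symm)
    ((Category.comp_id _).trans (Category.id_comp _).symm)

variable (P) in
/-- The equivalence between precrossed modules and reflexive graphs lifts the one between actions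
and split short exact sequences. -/
noncomputable def PXMod.forgetTargetIso :
    PXMod.toReflGraph ⋙ ReflGraph.forgetTarget ≅ PXMod.forgetMap ⋙ Act.semidirect (P := P) :=
  (NatIso.ofComponents (F := PXMod.forgetMap ⋙ Act.semidirect)
    (G := PXMod.toReflGraph ⋙ ReflGraph.forgetTarget)
    (fun M => asIso (X := Act.semidirect.obj M.act)
      (Y := ReflGraph.forgetTarget.obj (PXMod.toReflGraph.obj M)) M.forgetTargetInv)
    PXMod.forgetTargetInv_natural).symm

/-! ### Unit and counit for precrossed modules and reflexive graphs -/

/-- The comparison of a precrossed module with the one defined by its reflexive graph. -/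
noncomputable def PXMod.unitHom (M : P.PXMod) :
    M ⟶ ReflGraph.toPXMod.obj (PXMod.toReflGraph.obj M) where
  -- The action underlying `ReflGraph.toPXMod` is by definition `SplitExt.toAct` of the sequence of
  -- the graph. The unit for actions reaches the semidirect product sequence, and the second factor
  -- replaces X by the kernel.
  act := Act.unitIso.hom.app M.act ≫ SplitExt.toAct.map M.forgetTargetInv
  d_comm := by
    -- d is the restriction of (d, 1) to X, and the inclusion of X factors through the kernel by
    -- `SplitExt.toKernel_ι`.
    have h : M.d = (Act.semidirect.obj M.act).i ≫ M.target :=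
      Alg.hom_ext (biprod.inl_desc _ _).symm
    change M.d ≫ 𝟙 M.act.B ≫ 𝟙 M.act.B =
      (𝟙 M.act.X ≫ M.forgetTargetInv.fX) ≫ kernelι (Act.semidirect.obj M.act).p ≫ M.target
    refine ((congrArg (fun z => M.d ≫ z) (Category.comp_id _)).trans (Category.comp_id _)).trans ?_
    refine Eq.trans ?_ (congrArg (fun z => z ≫ _) (Category.id_comp M.forgetTargetInv.fX)).symm
    refine h.trans (Eq.trans ?_ (Category.assoc _ _ _))
    exact (congrArg (fun z => z ≫ M.target) (Act.semidirect.obj M.act).toKernel_ι).symm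

instance (M : P.PXMod) : IsIso M.unitHom :=
  have : IsIso M.unitHom.act :=
    inferInstanceAs (IsIso (Act.unitIso.hom.app M.act ≫ SplitExt.toAct.map M.forgetTargetInv))
  PXMod.isIso_of_isIso _

/-- A precrossed module is naturally isomorphic to the one defined by its reflexive graph. -/
noncomputable def PXMod.unitIso : 𝟭 P.PXMod ≅ PXMod.toReflGraph ⋙ ReflGraph.toPXMod :=
  NatIso.ofComponents (fun M => asIso (X := M)
    (Y := ReflGraph.toPXMod.obj (PXMod.toReflGraph.obj M)) M.unitHom)
    (fun {M M'} u => PXMod.hom_ext (by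
    change u.act ≫ Act.unitIso.hom.app M'.act ≫ SplitExt.toAct.map M'.forgetTargetInv =
      (Act.unitIso.hom.app M.act ≫ SplitExt.toAct.map M.forgetTargetInv) ≫
        SplitExt.toAct.map (ReflGraph.forgetTarget.map (PXMod.toReflGraph.map u))
    -- A morphism of precrossed modules is determined by its morphism of actions, so naturality
    -- follows from that of the two factors of the unit.
    rw [Category.assoc, ← Functor.map_comp, ← PXMod.forgetTargetInv_natural, Functor.map_comp]
    exact Act.unitIso.hom.naturality_assoc u.act _))

/-- The comparison of a reflexive graph with the one of the precrossed module which it defines. -/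
noncomputable def ReflGraph.counitHom (G : P.ReflGraph) :
    PXMod.toReflGraph.obj (ReflGraph.toPXMod.obj G) ⟶ G where
  fE := (ReflGraph.forgetTarget.obj G).descHom
  fB := 𝟙 G.B
  s_comm := (ReflGraph.forgetTarget.obj G).counitHom.p_comm
  t_comm := by
    have h : G.i.hom ≫ G.t.hom = 𝟙 _ := congrArg Alg.Hom.hom G.i_t
    refine Alg.hom_ext ?_
    change biprod.desc ((kernelι G.s).hom ≫ G.t.hom) (𝟙 G.B.carrier) ≫ 𝟙 G.B.carrier =
      biprod.desc (kernelι G.s).hom G.i.hom ≫ G.t.hom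
    refine (Category.comp_id _).trans ?_
    -- On the kernel summand both sides are the restriction of t, which is how d was defined; on B
    -- the equality is i ≫ t = 1.
    refine biprod.hom_ext' _ _ ?_ ?_
    · rw [biprod.inl_desc, biprod.inl_desc_assoc]
    · rw [biprod.inr_desc, biprod.inr_desc_assoc, h]
  i_comm := (ReflGraph.forgetTarget.obj G).counitHom.s_comm

instance (G : P.ReflGraph) : IsIso G.counitHom :=
  have : IsIso G.counitHom.fE := inferInstanceAs (IsIso (ReflGraph.forgetTarget.obj G).descHom)
  have : IsIso G.counitHom.fB := inferInstanceAs (IsIso (𝟙 G.B))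
  ReflGraph.isIso_of_isIso _

/-- A reflexive graph is naturally isomorphic to the one of the precrossed module which it
defines. -/
noncomputable def ReflGraph.counitIso : ReflGraph.toPXMod ⋙ PXMod.toReflGraph ≅ 𝟭 P.ReflGraph :=
  NatIso.ofComponents (fun G => asIso (X := PXMod.toReflGraph.obj (ReflGraph.toPXMod.obj G))
    (Y := G) G.counitHom) (fun u =>
    ReflGraph.hom_ext (SplitExt.descHom_natural (ReflGraph.forgetTarget.map u))
      ((Category.comp_id u.fB).trans (Category.id_comp u.fB).symm))

variable (P) in
/-- Precrossed modules are equivalent to reflexive graphs. -/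
noncomputable def pxModEquivReflGraph : P.PXMod ≌ P.ReflGraph :=
  CategoryTheory.Equivalence.mk PXMod.toReflGraph ReflGraph.toPXMod PXMod.unitIso
    ReflGraph.counitIso

end SymOperad


/-! ### The theorem -/

theorem mainTheorem7 {C : Type u} [Category.{v} C] [Abelian C] [HasLimits C] [HasColimits C]
    [MonoidalCategory C] [SymmetricCategory C] [MonoidalClosed C]
    (P : SymOperad C) [P.IsReduced] :
    ∃ (Φ : P.Act ≌ P.SplitExt) (Ψ : P.PXMod ≌ P.ReflGraph),
      Φ.functor = SymOperad.Act.semidirect ∧ Φ.inverse = SymOperad.SplitExt.toAct ∧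
      Ψ.functor = SymOperad.PXMod.toReflGraph ∧ Ψ.inverse = SymOperad.ReflGraph.toPXMod ∧
      Nonempty (Ψ.functor ⋙ SymOperad.ReflGraph.forgetTarget ≅
        SymOperad.PXMod.forgetMap ⋙ Φ.functor) := by
  -- That an action gives an algebra structure on X ⊕ B, and a split sequence an action, is already
  -- part of the construction of the functors. The four equalities hold by definition.
  exact ⟨SymOperad.actEquivSplitExt P, SymOperad.pxModEquivReflGraph P, rfl, rfl, rfl, rfl,
    ⟨SymOperad.PXMod.forgetTargetIso P⟩⟩
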